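/- Let $H$ be a separable Hilbert space and let $\alpha=\{\alpha_t:t\ge 0\}$ be an $E_0$-semigroup on $\mathcal B(H)$: a semigroup ($\alpha_0=\mathrm{id}$, $\alpha_{s+t}=\alpha_s\alpha_t$) of normal unital $*$-endomorphisms of $\mathcal B(H)$ such that $t\mapsto\langle\alpha_t(x)\xi,\eta\rangle$ is continuous for all $x\in\mathcal B(H)$ and $\xi,\eta\in H$. Assume that $\alpha$ is pure, i.e. $\bigcap_{t\ge0}\alpha_t(\mathcal B(H))=\mathbb C\mathbf 1$, and that $\omega$ is a normal state of $\mathcal B(H)$ with $\omega\circ\alpha_t=\omega$ for all $t\ge0$. Let $N_t=\alpha_t(\mathcal B(H))'$ be the commutant of $\alpha_t(\mathcal B(H))$, a type I factor. For a normal state $\varphi$ of a type I factor $M$, identify $M$ with some $\mathcal B(K)$ by a $*$-isomorphism, so that $\varphi(T)=\operatorname{trace}(RT)$ for a positive trace class operator $R$ on $K$. The eigenvalue list $\Lambda(\varphi)=(\lambda_k)_{k\ge1}$ is the sequence of positive eigenvalues of $R$, repeated according to multiplicity, in decreasing order and completed by zeros if there are only finitely many; it does not depend on the identification. Write $\|\Lambda-\Lambda'\|=\sum_{k}|\lambda_k-\lambda_k'|$.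 For normal states $\rho,\omega$ of $\mathcal B(H)$ let $\rho\otimes\omega$ be the unique normal state of $\mathcal B(H\otimes H)$ with $(\rho\otimes\omega)(S\otimes T)=\rho(S)\,\omega(T)$. Then for every normal state $\rho$ of $\mathcal B(H)$, $$\lim_{t\to\infty}\bigl\|\Lambda(\rho\restriction_{N_t})-\Lambda(\rho\otimes\omega)\bigr\|=0.$$ -/

import Mathlib

open scoped NNReal TensorProduct ComplexOrder

universe u

section Operators

variable {K : Type u} [NormedAddCommGroup K] [InnerProductSpace ℂ K]

/-- `A` is of trace class with trace `z`: over every orthonormal (Hilbert) basis the diagonal of `A`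
is summable, with sum `z`. (Summability of the diagonal over every orthonormal basis characterizes
the trace class operators among the bounded ones.) -/
def HasTrace (A : K →L[ℂ] K) (z : ℂ) : Prop :=
  ∀ (ι : Type u) (b : HilbertBasis ι ℂ K), HasSum (fun i => inner ℂ (b i) (A (b i))) z

/-- `R` is the density operator of the functional `φ` on `B(K)`: it is positive and
`φ(T) = trace(R T)` for all `T`. If `φ` is a state, then `T = 1` shows that `R` has trace one. -/
structure IsDensityOperator (R : K →L[ℂ] K) (φ : (K →L[ℂ] K) → ℂ) : Prop where
  isPositive : R.IsPositive
  hasTrace : ∀ T : K →L[ℂ] K, HasTrace (R ∘L T) (φ T)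

/-- `a` is the eigenvalue list `Λ(R)` of the positive trace class operator `R`: a decreasing
summable sequence of nonnegative reals, in which every positive real `μ` occurs as many times as
the dimension of the eigenspace of `R` for `μ`. (All positive eigenvalues, counted with
multiplicity, in decreasing order, completed by zeros if they are finite in number.) -/
structure IsOperatorEigenvalueList (R : K →L[ℂ] K) (a : ℕ → ℝ) : Prop where
  antitone : Antitone a
  nonneg : ∀ n, 0 ≤ a n
  summable : Summable a
  multiplicity : ∀ μ : ℝ, 0 < μ →
    {n : ℕ | a n = μ}.encard =
      Cardinal.toENat (Module.rank ℂ (Module.End.eigenspace (R : K →ₗ[ℂ] K) (μ : ℂ)))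

end Operators

/-- `a` is the eigenvalue list `Λ(φ)` of the normal state `φ` of the type I factor `M`: some
`*`-isomorphism of a `B(K)` onto `M` turns `φ` into a functional on `B(K)` with a density operator
whose eigenvalue list is `a`. -/
def IsEigenvalueList {M : Type u} [Ring M] [StarRing M] [Algebra ℂ M]
    (φ : M →ₗ[ℂ] ℂ) (a : ℕ → ℝ) : Prop :=
  ∃ (K : Type u) (_ : NormedAddCommGroup K) (_ : InnerProductSpace ℂ K) (_ : CompleteSpace K)
    (θ : (K →L[ℂ] K) ≃⋆ₐ[ℂ] M) (R : K →L[ℂ] K),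
    IsDensityOperator R (fun T => φ (θ T)) ∧ IsOperatorEigenvalueList R a

section Semigroups

variable {H : Type u} [NormedAddCommGroup H] [InnerProductSpace ℂ H]

/-- Normal states of `B(H)`. Normality is the preservation of suprema of (bounded) increasing nets
of operators, which is Scott continuity for the Loewner order. -/
structure IsNormalState (φ : (H →L[ℂ] H) →ₗ[ℂ] ℂ) : Prop where
  nonneg : ∀ T : H →L[ℂ] H, T.IsPositive → 0 ≤ φ T
  map_one : φ 1 = 1
  normal : ScottContinuous φ

/-- The Hilbert space tensor product `H ⊗ H`. -/
abbrev HilbertTensor (H : Type u) [NormedAddCommGroup H] [InnerProductSpace ℂ H] : Type u :=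
  UniformSpace.Completion (H ⊗[ℂ] H)

/-- The operator `S ⊗ T` on the Hilbert space tensor product `H ⊗ H`. -/
noncomputable def tensorOp (S T : H →L[ℂ] H) : HilbertTensor H →L[ℂ] HilbertTensor H :=
  (TensorProduct.mapL S T).completion

/-- `σ` is the product state `ρ ⊗ ω`: the normal state of `B(H ⊗ H)` with
`σ(S ⊗ T) = ρ(S) ω(T)`. -/
structure IsProductState (ρ ω : (H →L[ℂ] H) →ₗ[ℂ] ℂ)
    (σ : (HilbertTensor H →L[ℂ] HilbertTensor H) →ₗ[ℂ] ℂ) : Prop where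
  isNormalState : IsNormalState σ
  map_tensorOp : ∀ S T : H →L[ℂ] H, σ (tensorOp S T) = ρ S * ω T

variable [CompleteSpace H]

variable (H) in
/-- An `E₀`-semigroup acting on `B(H)`: a one-parameter semigroup of normal unital
`*`-endomorphisms, continuous in `t` for the weak operator topology at every operator. -/
structure EZeroSemigroup where
  /-- The endomorphism at time `t`. -/
  toFun : ℝ≥0 → ((H →L[ℂ] H) →⋆ₐ[ℂ] (H →L[ℂ] H))
  map_zero : toFun 0 = StarAlgHom.id ℂ (H →L[ℂ] H)
  map_add : ∀ s t, toFun (s + t) = (toFun s).comp (toFun t)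
  normal : ∀ t, ScottContinuous (toFun t)
  continuous : ∀ (x : H →L[ℂ] H) (ξ η : H), Continuous fun t => inner ℂ ξ (toFun t x η)

namespace EZeroSemigroup

/-- Purity: the intersection of the ranges `α_t(B(H))` consists of the scalars only. -/
def IsPure (α : EZeroSemigroup H) : Prop :=
  ⨅ t, (α.toFun t).range = (⊥ : StarSubalgebra ℂ (H →L[ℂ] H))

/-- The commutant `N_t = α_t(B(H))'`. -/
noncomputable def commutant (α : EZeroSemigroup H) (t : ℝ≥0) : StarSubalgebra ℂ (H →L[ℂ] H) :=
  StarSubalgebra.centralizer ℂ (Set.range (α.toFun t))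

/-- The restriction of a functional on `B(H)` to `N_t`. -/
noncomputable def restrict (α : EZeroSemigroup H) (ρ : (H →L[ℂ] H) →ₗ[ℂ] ℂ) (t : ℝ≥0) :
    α.commutant t →ₗ[ℂ] ℂ :=
  ρ ∘ₗ ((α.commutant t).subtype : α.commutant t →ₗ[ℂ] (H →L[ℂ] H))

end EZeroSemigroup

end Semigroups

/-! Purity and invariance force `α_t(x) → ω(x) 1` in the weak operator topology
(`EZeroSemigroup.tendstoWeakly`). Balls are weakly compact and `α_t` is normal, so a weak limit
point of `α_s(x) = α_t(α_{s-t}(x))` as `s → ∞` lies in the range of every `α_t`. It is therefore a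
scalar, and the invariant normal state `ω` identifies this scalar.

Write `ρ = ∑ ⟨x_i, · x_i⟩` with orthogonal `x_i` and `‖x_i‖² = r_i`, let `c_j` be an eigenbasis for
`ω` with eigenvalues `s_j`, and let `e` be one of the `c_j`. On the range of the projection
`α_t(|e⟩⟨e|)` the factor `N_t` acts faithfully as the algebra of all bounded operators, and there
the restriction of `ρ` is the sum of the vector functionals of `v_ij = α_t(|e⟩⟨c_j|) x_i`. The Gram
matrix has the entries `⟨x_i, α_t(|c_j⟩⟨c_l|) x_k⟩`, which tend to `ω(|c_j⟩⟨c_l|) ⟨x_i, x_k⟩`: to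
`r_i s_j` on the diagonal and to `0` off it. The numbers `r_i s_j` are the eigenvalues of `ρ ⊗ ω`.

It remains to see that eigenvalue lists follow Gram matrices, although the Hilbert space varies with
`t`. The Ky Fan maximum principle for almost orthonormal vectors (`IsResolution.sum_rankOne_le`)
bounds the partial sums of the list from below, and a dual argument with the complement of a
spectral projection bounds them from above (`tendsto_sum_range_of_gram`). Since all lists have mass
one, convergence of partial sums upgrades to `ℓ¹` convergence by Scheffé's argument
(`tendsto_tsum_abs_sub`). The Ky Fan principle also shows that a list does not depend on the
identification of the factor with some `B(K)`. -/

open Filter Topology InnerProductSpace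

/-! ### Weak operator convergence and normal functionals. -/

section WeakConvergence

variable {H : Type*} [NormedAddCommGroup H] [InnerProductSpace ℂ H]

/-- Convergence of a family of operators in the weak operator topology. -/
def TendstoWeakly {ι : Type*} (T : ι → H →L[ℂ] H) (l : Filter ι) (S : H →L[ℂ] H) : Prop :=
  ∀ ξ η, Tendsto (fun i => inner ℂ ξ (T i η)) l (𝓝 (inner ℂ ξ (S η)))

/-- Positive functionals on `B(H)` that are Scott continuous. -/
structure IsNormalPositive (φ : (H →L[ℂ] H) →ₗ[ℂ] ℂ) : Prop where
  nonneg : ∀ T : H →L[ℂ] H, T.IsPositive → 0 ≤ φ T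
  normal : ScottContinuous φ

theorem isPositive_iff_inner_nonneg (T : H →L[ℂ] H) :
    T.IsPositive ↔ ∀ x, 0 ≤ inner ℂ x (T x) := by
  refine ⟨fun h x => h.inner_nonneg_right x, fun h => ?_⟩
  rw [ContinuousLinearMap.isPositive_iff_complex]
  intro x
  have h1 : inner ℂ (T x) x = inner ℂ x (T x) := by
    rw [← inner_conj_symm, Complex.conj_eq_iff_im]
    exact (Complex.le_def.1 (h x)).2.symm
  rw [h1]
  obtain ⟨h2, h3⟩ := Complex.le_def.1 (h x)
  refine ⟨Complex.ext (by simp) (by simpa using h3), by simpa using h2⟩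

theorem TendstoWeakly.unique {ι : Type*} {T : ι → H →L[ℂ] H} {l : Filter ι} [l.NeBot]
    {S S' : H →L[ℂ] H} (h : TendstoWeakly T l S) (h' : TendstoWeakly T l S') : S = S' := by
  ext η
  exact ext_inner_left ℂ fun ξ => tendsto_nhds_unique (h ξ η) (h' ξ η)

theorem TendstoWeakly.congr' {ι : Type*} {T T' : ι → H →L[ℂ] H} {l : Filter ι}
    {S : H →L[ℂ] H} (h : TendstoWeakly T l S) (hT : ∀ᶠ i in l, T i = T' i) :
    TendstoWeakly T' l S :=
  fun ξ η => (h ξ η).congr' (hT.mono fun i hi => by rw [hi])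

theorem tendstoWeakly_of_inner_self {ι : Type*} {T : ι → H →L[ℂ] H} {l : Filter ι}
    {S : H →L[ℂ] H} (h : ∀ ξ, Tendsto (fun i => inner ℂ ξ (T i ξ)) l (𝓝 (inner ℂ ξ (S ξ)))) :
    TendstoWeakly T l S := by
  have h' : ∀ ξ, Tendsto (fun i => inner ℂ (T i ξ) ξ) l (𝓝 (inner ℂ (S ξ) ξ)) := by
    intro ξ
    have := (Complex.continuous_conj.tendsto _).comp (h ξ)
    simpa [Function.comp_def, inner_conj_symm] using this
  have h'' : ∀ ξ η, Tendsto (fun i => inner ℂ (T i η) ξ) l (𝓝 (inner ℂ (S η) ξ)) := by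
    intro ξ η
    have e : ∀ A : H →L[ℂ] H, inner ℂ (A η) ξ = _ := fun A => inner_map_polarization A.toLinearMap ξ η
    simp only [ContinuousLinearMap.coe_coe] at e
    simp_rw [e]
    exact ((((h' _).sub (h' _)).add ((h' _).const_mul _)).sub ((h' _).const_mul _)).div_const _
  intro ξ η
  have := (Complex.continuous_conj.tendsto _).comp (h'' ξ η)
  simpa [Function.comp_def, inner_conj_symm] using this

/-- Weak compactness of balls: along an ultrafilter every bounded matrix entry converges, and the
limits form a bounded sesquilinear form, hence come from an operator. -/
theorem exists_tendstoWeakly [CompleteSpace H] {ι : Type*} (U : Ultrafilter ι)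
    (T : ι → H →L[ℂ] H) (C : ℝ) (hT : ∀ᶠ i in U, ‖T i‖ ≤ C) :
    ∃ S, TendstoWeakly T U S := by
  have hb : ∀ ξ η, ∀ᶠ i in U, inner ℂ ξ (T i η) ∈ Metric.closedBall (0 : ℂ) (C * ‖ξ‖ * ‖η‖) := by
    intro ξ η
    filter_upwards [hT] with i hi
    rw [mem_closedBall_zero_iff]
    calc ‖inner ℂ ξ (T i η)‖ ≤ ‖ξ‖ * ‖T i η‖ := norm_inner_le_norm _ _
      _ ≤ ‖ξ‖ * (C * ‖η‖) := by gcongr; exact (T i).le_of_opNorm_le hi η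
      _ = _ := by ring
  have hlim : ∀ ξ η, ∃ z ∈ Metric.closedBall (0 : ℂ) (C * ‖ξ‖ * ‖η‖),
      Tendsto (fun i => inner ℂ ξ (T i η)) U (𝓝 z) := by
    intro ξ η
    obtain ⟨z, hz, h⟩ := (isCompact_closedBall (0 : ℂ) (C * ‖ξ‖ * ‖η‖)).ultrafilter_le_nhds'
      (U.map fun i => inner ℂ ξ (T i η)) (hb ξ η)
    exact ⟨z, hz, h⟩
  choose B hB hlimB using hlim
  let L : H →ₗ⋆[ℂ] H →ₗ[ℂ] ℂ := LinearMap.mk₂'ₛₗ (starRingEnd ℂ) (RingHom.id ℂ) B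
    (fun x y z => tendsto_nhds_unique (hlimB (x + y) z)
      (by simpa [inner_add_left] using (hlimB x z).add (hlimB y z)))
    (fun c x z => tendsto_nhds_unique (hlimB (c • x) z)
      (by simpa [inner_smul_left, mul_comm] using (hlimB x z).const_mul (starRingEnd ℂ c)))
    (fun x y z => tendsto_nhds_unique (hlimB x (y + z))
      (by simpa [inner_add_right] using (hlimB x y).add (hlimB x z)))
    (fun c x z => tendsto_nhds_unique (hlimB x (c • z))
      (by simpa [inner_smul_right] using (hlimB x z).const_mul c))
  let L' := L.mkContinuous₂ C (fun x y => mem_closedBall_zero_iff.1 (hB x y))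
  refine ⟨(InnerProductSpace.continuousLinearMapOfBilin L').adjoint, fun ξ η => ?_⟩
  rw [ContinuousLinearMap.adjoint_inner_right,
    InnerProductSpace.continuousLinearMapOfBilin_apply]
  exact hlimB ξ η

theorem norm_inner_apply_self_le (T : H →L[ℂ] H) (x : H) :
    ‖inner ℂ x (T x)‖ ≤ ‖T‖ * ‖x‖ ^ 2 :=
  calc ‖inner ℂ x (T x)‖ ≤ ‖x‖ * ‖T x‖ := norm_inner_le_norm _ _
    _ ≤ ‖x‖ * (‖T‖ * ‖x‖) := by gcongr; exact T.le_opNorm x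
    _ = _ := by ring

/-- A convergent sum of vector functionals is weakly continuous on bounded sets. -/
theorem tendsto_of_hasSum_inner {ι κ : Type*} {φ : (H →L[ℂ] H) → ℂ} {x : ι → H}
    (hx : Summable fun i => ‖x i‖ ^ 2)
    (hφ : ∀ T : H →L[ℂ] H, HasSum (fun i => inner ℂ (x i) (T (x i))) (φ T))
    {T : κ → H →L[ℂ] H} {l : Filter κ} {S : H →L[ℂ] H} {C : ℝ} (hT : ∀ᶠ k in l, ‖T k‖ ≤ C)
    (h : TendstoWeakly T l S) : Tendsto (fun k => φ (T k)) l (𝓝 (φ S)) := by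
  simp_rw [← fun T => (hφ T).tsum_eq]
  refine tendsto_tsum_of_dominated_convergence (bound := fun i => C * ‖x i‖ ^ 2)
    (hx.mul_left C) (fun i => h _ _) ?_
  filter_upwards [hT] with k hk i
  exact (norm_inner_apply_self_le _ _).trans (by gcongr)

variable [CompleteSpace H]

/-- By compactness the directed set has a weak limit along an ultrafilter finer than its order;
positivity survives weak limits, so this limit is an upper bound and lies below `a`. -/
theorem exists_tendstoWeakly_of_isLUB {d : Set (H →L[ℂ] H)} {a : H →L[ℂ] H} (hne : d.Nonempty)
    (hd : DirectedOn (· ≤ ·) d) (ha : IsLUB d a) :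
    ∃ (U : Ultrafilter d) (C : ℝ), (∀ᶠ T : d in U, ‖a - T‖ ≤ C) ∧
      TendstoWeakly (fun T : d => (T : H →L[ℂ] H)) U a := by
  have : Nonempty d := hne.to_subtype
  have : IsDirectedOrder d := ⟨fun x y => by
    obtain ⟨z, hz, h1, h2⟩ := hd x x.2 y y.2
    exact ⟨⟨z, hz⟩, h1, h2⟩⟩
  obtain ⟨T₀⟩ := ‹Nonempty d›
  have hU : (Ultrafilter.of (atTop : Filter d) : Filter d) ≤ atTop := Ultrafilter.of_le _
  -- The set `d` may be unbounded below, but `0 ≤ a - T ≤ a - T₀` from any fixed `T₀` on.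
  have hbd : ∀ᶠ T : d in (Ultrafilter.of (atTop : Filter d) : Filter d),
      ‖a - T‖ ≤ ‖a - T₀‖ := by
    filter_upwards [hU (eventually_ge_atTop T₀)] with T hT
    refine CStarAlgebra.norm_le_norm_of_nonneg_of_le
      ((ContinuousLinearMap.nonneg_iff_isPositive _).2 (ha.1 T.2)) ?_
    rw [ContinuousLinearMap.le_def]
    have : T₀.1 ≤ T.1 := hT
    rw [ContinuousLinearMap.le_def] at this
    simpa using this
  refine ⟨Ultrafilter.of atTop, ‖a - T₀‖, hbd, ?_⟩
  obtain ⟨b, hb⟩ := exists_tendstoWeakly (Ultrafilter.of (atTop : Filter d))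
    (fun T : d => (T : H →L[ℂ] H)) (‖a‖ + ‖a - T₀‖) (by
      filter_upwards [hbd] with T hT
      calc ‖(T : H →L[ℂ] H)‖ = ‖a - (a - T)‖ := by simp
        _ ≤ ‖a‖ + ‖a - T‖ := norm_sub_le _ _
        _ ≤ _ := by gcongr)
  have h1 : a ≤ b := ha.2 fun T hT => by
    rw [ContinuousLinearMap.le_def, isPositive_iff_inner_nonneg]
    intro x
    rw [sub_apply, inner_sub_right, sub_nonneg]
    refine ge_of_tendsto (hb x x) ?_
    filter_upwards [hU (eventually_ge_atTop ⟨T, hT⟩)] with T' hT'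
    have : T ≤ T'.1 := hT'
    rw [ContinuousLinearMap.le_def, isPositive_iff_inner_nonneg] at this
    simpa [inner_sub_right, sub_nonneg] using this x
  have h2 : b ≤ a := by
    rw [ContinuousLinearMap.le_def, isPositive_iff_inner_nonneg]
    intro x
    rw [sub_apply, inner_sub_right, sub_nonneg]
    refine le_of_tendsto (hb x x) (Eventually.of_forall fun T' => ?_)
    have : T'.1 ≤ a := ha.1 T'.2
    rw [ContinuousLinearMap.le_def, isPositive_iff_inner_nonneg] at this
    simpa [inner_sub_right, sub_nonneg] using this x
  rwa [le_antisymm h1 h2]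

theorem IsNormalPositive.of_hasSum {ι : Type*} {φ : (H →L[ℂ] H) →ₗ[ℂ] ℂ} {x : ι → H}
    (hx : Summable fun i => ‖x i‖ ^ 2)
    (hφ : ∀ T : H →L[ℂ] H, HasSum (fun i => inner ℂ (x i) (T (x i))) (φ T)) :
    IsNormalPositive φ := by
  have hpos : ∀ T : H →L[ℂ] H, T.IsPositive → 0 ≤ φ T := fun T hT =>
    (hφ T).nonneg fun i => hT.inner_nonneg_right _
  refine ⟨hpos, fun d hne hd a ha => ⟨?_, fun c hc => ?_⟩⟩
  · rintro _ ⟨T, hT, rfl⟩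
    have := hpos _ (ha.1 hT)
    simpa using this
  · obtain ⟨U, C, hC, hU⟩ := exists_tendstoWeakly_of_isLUB hne hd ha
    have h0 : Tendsto (fun T : d => φ (a - T)) U (𝓝 (φ 0)) := by
      refine tendsto_of_hasSum_inner hx hφ hC fun ξ η => ?_
      simpa [inner_sub_right] using (hU ξ η).const_sub (inner ℂ ξ (a η))
    have h1 : Tendsto (fun T : d => φ T) U (𝓝 (φ a)) := by
      simpa using h0.const_sub (φ a)
    exact le_of_tendsto h1 (Eventually.of_forall fun T => hc ⟨T, T.2, rfl⟩)

/-- The functional `T ↦ ⟨ξ, T ξ⟩`. -/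
noncomputable def vectorFunctional (ξ : H) : (H →L[ℂ] H) →ₗ[ℂ] ℂ where
  toFun T := inner ℂ ξ (T ξ)
  map_add' S T := by simp
  map_smul' c T := by simp

theorem isNormalPositive_vectorFunctional (ξ : H) : IsNormalPositive (vectorFunctional ξ) :=
  .of_hasSum (ι := Unit) (x := fun _ => ξ) Summable.of_finite fun T => by
    convert hasSum_fintype (fun _ : Unit => inner ℂ ξ (T ξ)); simp [vectorFunctional]

end WeakConvergence

/-! ### Density operators of normal functionals. -/

section DensityOperators

theorem rankOne_mul_rankOne {H : Type*} [NormedAddCommGroup H] [InnerProductSpace ℂ H]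
    (x y z w : H) : rankOne ℂ x y * rankOne ℂ z w = inner ℂ y z • rankOne ℂ x w := by
  ext v
  simp [smul_smul, mul_comm]

theorem star_rankOne {H : Type*} [NormedAddCommGroup H] [InnerProductSpace ℂ H] [CompleteSpace H]
    (x y : H) : star (rankOne ℂ x y) = rankOne ℂ y x := by
  rw [ContinuousLinearMap.star_eq_adjoint, adjoint_rankOne]

variable {H : Type*} [NormedAddCommGroup H] [InnerProductSpace ℂ H]

/-- The projection onto the span of finitely many basis vectors. -/
noncomputable def partialIdentity {ι : Type*} (b : ι → H) (F : Finset ι) : H →L[ℂ] H :=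
  ∑ i ∈ F, InnerProductSpace.rankOne ℂ (b i) (b i)

theorem partialIdentity_mul_self {ι : Type*} {b : ι → H} (hb : Orthonormal ℂ b) (F : Finset ι) :
    partialIdentity b F * partialIdentity b F = partialIdentity b F := by
  classical
  simp only [partialIdentity, Finset.sum_mul_sum, rankOne_mul_rankOne,
    orthonormal_iff_ite.1 hb, ite_smul, one_smul, zero_smul, Finset.sum_ite_eq]
  exact Finset.sum_congr rfl fun i hi => by simp [hi]

theorem tendsto_inner_partialIdentity {ι : Type*} (b : HilbertBasis ι ℂ H) (x y : H) :
    Tendsto (fun F => inner ℂ x (partialIdentity b F y)) atTop (𝓝 (inner ℂ x y)) := by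
  have := b.hasSum_inner_mul_inner x y
  simpa [HasSum, partialIdentity, sum_apply, inner_sum, inner_smul_right,
    mul_comm] using this

theorem partialIdentity_mono {ι : Type*} (b : ι → H) : Monotone (partialIdentity b) := by
  classical
  intro F G h
  rw [ContinuousLinearMap.le_def, partialIdentity, partialIdentity, ← Finset.sum_sdiff h,
    add_sub_cancel_right]
  exact ContinuousLinearMap.isPositive_sum _ fun i _ => InnerProductSpace.isPositive_rankOne_self _

variable [CompleteSpace H]

/-- The Cauchy-Schwarz inequality for a positive functional. -/
theorem norm_apply_star_mul_sq_le {φ : (H →L[ℂ] H) →ₗ[ℂ] ℂ}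
    (hφ : ∀ T : H →L[ℂ] H, T.IsPositive → 0 ≤ φ T) (S T : H →L[ℂ] H) :
    ‖φ (star S * T)‖ ^ 2 ≤ (φ (star S * S)).re * (φ (star T * T)).re := by
  let f : (H →L[ℂ] H) →ₚ[ℂ] ℂ := PositiveLinearMap.mk₀ φ fun T hT =>
    hφ T ((ContinuousLinearMap.nonneg_iff_isPositive _).1 hT)
  have h := norm_inner_le_norm (𝕜 := ℂ) (f.toPreGNS S) (f.toPreGNS T)
  have e : ∀ A, ‖f.toPreGNS A‖ ^ 2 = (φ (star A * A)).re := fun A => by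
    have := f.preGNS_norm_sq (f.toPreGNS A)
    exact_mod_cast congrArg Complex.re this
  calc ‖φ (star S * T)‖ ^ 2 ≤ (‖f.toPreGNS S‖ * ‖f.toPreGNS T‖) ^ 2 := by gcongr; exact h
    _ = _ := by rw [mul_pow, e, e]

/-- Cauchy-Schwarz against `1`, together with `T* T ≤ ‖T‖² 1`. -/
theorem norm_apply_le_of_nonneg {φ : (H →L[ℂ] H) →ₗ[ℂ] ℂ}
    (hφ : ∀ T : H →L[ℂ] H, T.IsPositive → 0 ≤ φ T) (T : H →L[ℂ] H) :
    ‖φ T‖ ≤ (φ 1).re * ‖T‖ := by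
  have h1 : 0 ≤ (φ 1).re := (Complex.le_def.1 (hφ 1 ContinuousLinearMap.isPositive_one)).1
  have h2 : (φ (star T * T)).re ≤ ‖T‖ ^ 2 * (φ 1).re := by
    have : star T * T ≤ ((‖T‖ ^ 2 : ℝ) : ℂ) • (1 : H →L[ℂ] H) := by
      rw [ContinuousLinearMap.le_def, isPositive_iff_inner_nonneg]
      intro x
      have e : inner ℂ x ((((‖T‖ ^ 2 : ℝ) : ℂ) • (1 : H →L[ℂ] H) - star T * T) x)
          = ((‖T‖ ^ 2 * ‖x‖ ^ 2 - ‖T x‖ ^ 2 : ℝ) : ℂ) := by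
        rw [ContinuousLinearMap.star_eq_adjoint]
        simp [ContinuousLinearMap.adjoint_inner_right,
          inner_self_eq_norm_sq_to_K]
      rw [e, Complex.zero_le_real, sub_nonneg, ← mul_pow]
      gcongr
      exact T.le_opNorm x
    have h3 := (Complex.le_def.1 (hφ _ ((ContinuousLinearMap.le_def _ _).1 this))).1
    simp only [map_sub, map_smul, Complex.zero_re, Complex.sub_re, smul_eq_mul,
      Complex.re_ofReal_mul] at h3
    linarith
  have h := norm_apply_star_mul_sq_le hφ 1 T
  simp only [star_one, one_mul] at h
  refine abs_le_of_sq_le_sq' ?_ (by positivity) |>.2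
  nlinarith

theorem star_partialIdentity {ι : Type*} (b : ι → H) (F : Finset ι) :
    star (partialIdentity b F) = partialIdentity b F := by
  simp [partialIdentity, star_rankOne]

theorem isPositive_one_sub_partialIdentity {ι : Type*} {b : ι → H} (hb : Orthonormal ℂ b)
    (F : Finset ι) : (1 - partialIdentity b F).IsPositive := by
  have : 1 - partialIdentity b F = star (1 - partialIdentity b F) * (1 - partialIdentity b F) := by
    rw [star_sub, star_one, star_partialIdentity, mul_sub, sub_mul, sub_mul,
      partialIdentity_mul_self hb]
    simp
  rw [← ContinuousLinearMap.nonneg_iff_isPositive, this]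
  exact star_mul_self_nonneg _

theorem isLUB_range_partialIdentity {ι : Type*} (b : HilbertBasis ι ℂ H) :
    IsLUB (Set.range (partialIdentity b)) 1 := by
  refine ⟨?_, fun S hS => ?_⟩
  · rintro _ ⟨F, rfl⟩
    exact isPositive_one_sub_partialIdentity b.orthonormal F
  · rw [ContinuousLinearMap.le_def, isPositive_iff_inner_nonneg]
    intro x
    rw [sub_apply, inner_sub_right, sub_nonneg]
    refine le_of_tendsto (tendsto_inner_partialIdentity b x x) (Eventually.of_forall fun F => ?_)
    have := hS ⟨F, rfl⟩
    rw [ContinuousLinearMap.le_def, isPositive_iff_inner_nonneg] at this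
    simpa [inner_sub_right, sub_nonneg] using this x

/-- Scott continuity is needed for one net only: the finite rank projections along the basis, which
increase to `1`. -/
theorem IsNormalPositive.hasSum_rankOne {φ : (H →L[ℂ] H) →ₗ[ℂ] ℂ} (hφ : IsNormalPositive φ)
    {ι : Type*} (b : HilbertBasis ι ℂ H) :
    HasSum (fun i => φ (rankOne ℂ (b i) (b i))) (φ 1) := by
  have hnn : ∀ i, 0 ≤ φ (rankOne ℂ (b i) (b i)) := fun i =>
    hφ.nonneg _ (isPositive_rankOne_self _)
  have hle : ∀ F, φ (partialIdentity b F) ≤ φ 1 := fun F => by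
    have := hφ.nonneg _ (isPositive_one_sub_partialIdentity b.orthonormal F)
    simpa using this
  have hre : ∀ i, φ (rankOne ℂ (b i) (b i)) = ((φ (rankOne ℂ (b i) (b i))).re : ℂ) := fun i =>
    Complex.eq_re_of_ofReal_le (r := 0) (by simpa using hnn i)
  have hF : ∀ F, φ (partialIdentity b F) =
      ((∑ i ∈ F, (φ (rankOne ℂ (b i) (b i))).re : ℝ) : ℂ) := fun F => by
    rw [partialIdentity, map_sum, Complex.ofReal_sum]
    exact Finset.sum_congr rfl fun i _ => hre i
  have hs : Summable fun i => (φ (rankOne ℂ (b i) (b i))).re := by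
    refine summable_of_sum_le (c := (φ 1).re) (fun i => (Complex.le_def.1 (hnn i)).1) fun F => ?_
    have := (Complex.le_def.1 (hle F)).1
    rwa [hF, Complex.ofReal_re] at this
  have hlub := hφ.normal (Set.range_nonempty _)
    (directedOn_range.2 (partialIdentity_mono b).directed_le) (isLUB_range_partialIdentity b)
  have h1 : φ 1 ≤ ((∑' i, (φ (rankOne ℂ (b i) (b i))).re : ℝ) : ℂ) := by
    refine hlub.2 ?_
    rintro _ ⟨_, ⟨F, rfl⟩, rfl⟩
    rw [hF]
    exact_mod_cast hs.sum_le_tsum F fun i _ => (Complex.le_def.1 (hnn i)).1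
  have h2 : ((∑' i, (φ (rankOne ℂ (b i) (b i))).re : ℝ) : ℂ) ≤ φ 1 := by
    refine le_of_tendsto ((Complex.continuous_ofReal.tendsto _).comp hs.hasSum)
      (Eventually.of_forall fun F => ?_)
    rw [Function.comp, ← hF]
    exact hle F
  rw [le_antisymm h1 h2, funext hre]
  exact_mod_cast hs.hasSum

/-- The form `(η, ξ) ↦ φ(|ξ⟩⟨η|)` is bounded, so it is given by an operator `R`. A partial sum of
the trace of `R T` is `φ(T P)` with `P` a finite rank projection, and `|φ(T (1 - P))|² ≤ φ(T T*) φ(1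
- P)` tends to zero by normality. -/
theorem IsNormalPositive.exists_isDensityOperator {H : Type u} [NormedAddCommGroup H]
    [InnerProductSpace ℂ H] [CompleteSpace H] {φ : (H →L[ℂ] H) →ₗ[ℂ] ℂ}
    (hφ : IsNormalPositive φ) : ∃ R, IsDensityOperator R φ := by
  let L : H →ₗ⋆[ℂ] H →ₗ[ℂ] ℂ := LinearMap.mk₂'ₛₗ (starRingEnd ℂ) (RingHom.id ℂ)
    (fun η ξ => φ (rankOne ℂ ξ η)) (by simp) (by simp) (by simp) (by simp)
  let L' := L.mkContinuous₂ (φ 1).re (fun η ξ => by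
    refine (norm_apply_le_of_nonneg hφ.nonneg (rankOne ℂ ξ η)).trans_eq ?_
    rw [norm_rankOne]; ring)
  obtain ⟨R, hR⟩ : ∃ R : H →L[ℂ] H, ∀ η ξ, inner ℂ η (R ξ) = φ (rankOne ℂ ξ η) := by
    refine ⟨(continuousLinearMapOfBilin L').adjoint, fun η ξ => ?_⟩
    rw [ContinuousLinearMap.adjoint_inner_right, continuousLinearMapOfBilin_apply]
    rfl
  refine ⟨R, (isPositive_iff_inner_nonneg R).2 fun x => ?_, fun T ι b => ?_⟩
  · rw [hR]
    exact hφ.nonneg _ (isPositive_rankOne_self _)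
  · have h0 : Tendsto (fun F => (φ (1 - partialIdentity b F)).re) atTop (𝓝 0) := by
      have h := (hφ.hasSum_rankOne b).const_sub (φ 1)
      rw [sub_self] at h
      have h' := (Complex.continuous_re.tendsto _).comp h
      refine h'.congr fun F => ?_
      simp [partialIdentity]
    have h1 : Tendsto (fun F => φ (T * (1 - partialIdentity b F))) atTop (𝓝 0) := by
      refine squeeze_zero_norm (a := fun F =>
        √((φ (T * star T)).re * (φ (1 - partialIdentity b F)).re)) (fun F => ?_) ?_
      · refine Real.le_sqrt_of_sq_le ?_
        have h := norm_apply_star_mul_sq_le hφ.nonneg (star T) (1 - partialIdentity b F)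
        have e : star (1 - partialIdentity b F) * (1 - partialIdentity b F)
            = 1 - partialIdentity b F := by
          rw [star_sub, star_one, star_partialIdentity, mul_sub, sub_mul, sub_mul,
            partialIdentity_mul_self b.orthonormal]
          simp
        rwa [e, star_star] at h
      · simpa using (h0.const_mul (φ (T * star T)).re).sqrt
    have h2 := h1.const_sub (φ T)
    rw [sub_zero] at h2
    refine h2.congr fun F => ?_
    rw [mul_sub, mul_one, map_sub, sub_sub_cancel, partialIdentity, Finset.mul_sum, map_sum]
    refine Finset.sum_congr rfl fun i _ => ?_
    rw [ContinuousLinearMap.mul_def, comp_rankOne, ← hR]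
    rfl

end DensityOperators

/-! ### Decreasing rearrangement of summable families. -/

section Rearrangement

theorem Summable.finite_le_of_pos {ι : Type*} {r : ι → ℝ} (hr : Summable r) {x : ℝ} (hx : 0 < x) :
    {i | x ≤ r i}.Finite := by
  have h := hr.tendsto_cofinite_zero.eventually (gt_mem_nhds hx)
  simpa [Filter.eventually_cofinite] using h

theorem exists_equiv_sigma_fiber {ι : Type*} (c : ι → ℝ) :
    ∃ g : {i | 0 < c i} ≃ Σ μ : {μ : ℝ // 0 < μ}, {i | c i = μ}, ∀ i, ((g i).2 : ι) = i :=
  ⟨{ toFun := fun i => ⟨⟨c i, i.2⟩, ⟨i, rfl⟩⟩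
     invFun := fun p => ⟨p.2, by
      have h : c p.2 = p.1 := p.2.2
      exact p.1.2.trans_eq h.symm⟩
     left_inv := fun i => rfl
     right_inv := fun p => by
      obtain ⟨⟨μ, hμ⟩, ⟨i, hi⟩⟩ := p
      have hi' : c i = μ := hi
      subst hi'
      rfl }, fun i => rfl⟩

/-- Two families of reals whose positive values have the same finite multiplicities agree, up to
reindexing, where they are positive. -/
theorem exists_equiv_of_encard_fiber_eq {ι κ : Type*} {a : ι → ℝ} {r : κ → ℝ}
    (hr : ∀ μ, 0 < μ → {k | r k = μ}.Finite)
    (h : ∀ μ, 0 < μ → {i | a i = μ}.encard = {k | r k = μ}.encard) :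
    ∃ e : {i | 0 < a i} ≃ {k | 0 < r k}, ∀ i, r (e i) = a i := by
  have h1 : ∀ μ : {μ : ℝ // 0 < μ}, Nonempty ({i | a i = μ} ≃ {k | r k = μ}) := fun μ => by
    have hfin : {i | a i = μ}.Finite := by
      rw [← Set.encard_ne_top_iff, h μ μ.2, Set.encard_ne_top_iff]; exact hr μ μ.2
    have := hfin.fintype
    have := (hr μ μ.2).fintype
    rw [← Fintype.card_eq]
    have h2 := h μ μ.2
    rw [← Nat.card_eq_fintype_card, ← Nat.card_eq_fintype_card, Nat.card_coe_set_eq,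
      Nat.card_coe_set_eq, Set.ncard, Set.ncard, h2]
  let e := fun μ => (h1 μ).some
  obtain ⟨g, hg⟩ := exists_equiv_sigma_fiber a
  obtain ⟨g', hg'⟩ := exists_equiv_sigma_fiber r
  have hgv : ∀ i, ((g i).1 : ℝ) = a i := fun i => by
    rw [← hg i]; exact (g i).2.2.symm
  refine ⟨(g.trans (Equiv.sigmaCongrRight e)).trans g'.symm, fun i => ?_⟩
  have h3 := hg' (g'.symm (Equiv.sigmaCongrRight e (g i)))
  rw [Equiv.apply_symm_apply] at h3
  simp only [Equiv.trans_apply]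
  rw [← h3, ← hgv]
  exact (Equiv.sigmaCongrRight e (g i)).2.2

/-- The list is the generalized inverse of the counting function `M x = #{i | x ≤ r i}`: for `μ > 0`
one has `μ ≤ a n` exactly when `n < M μ`. Hence the indices with `a n = μ` form the interval from
`#{i | μ < r i}` to `#{i | μ ≤ r i}`, which has the right length. -/
theorem exists_antitone_rearrangement {ι : Type*} {r : ι → ℝ} (hr : Summable r) (hr0 : ∀ i, 0 ≤ r i) :
    ∃ a : ℕ → ℝ, Antitone a ∧ (∀ n, 0 ≤ a n) ∧ Summable a ∧
      ∀ μ, 0 < μ → {n | a n = μ}.encard = {i | r i = μ}.encard := by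
  set M : ℝ → ℕ := fun x => {i | x ≤ r i}.ncard with hM
  -- When at most `n` values of `r` are positive the set is empty, and `sSup ∅ = 0` completes the
  -- list by zeros.
  set a : ℕ → ℝ := fun n => sSup {x | 0 < x ∧ n < M x} with ha
  have ha0 : ∀ n, 0 ≤ a n := fun n => Real.sSup_nonneg fun x hx => hx.1.le
  have key : ∀ n μ, 0 < μ → (μ ≤ a n ↔ n < M μ) := by
    intro n μ hμ
    constructor
    · intro h
      by_contra! hn
      -- Its maximum `m < μ` leaves no value of `r` strictly between `m` and `μ`, so `M` is constant
      -- on `(m, μ]` and `a n` cannot exceed `m`. The point `μ / 2` keeps `m` positive and the set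
      -- nonempty.
      have hA : (insert (μ / 2) (r '' {i | μ / 2 ≤ r i ∧ r i < μ})).Finite :=
        (((hr.finite_le_of_pos (half_pos hμ)).subset fun i hi => hi.1).image _).insert _
      obtain ⟨m, hm, hmax⟩ := hA.exists_maximalFor id _ (Set.insert_nonempty _ _)
      have hmax' : ∀ y ∈ (insert (μ / 2) (r '' {i | μ / 2 ≤ r i ∧ r i < μ})), y ≤ m := fun y hy =>
        (le_total y m).elim id fun h => hmax hy h
      have hmμ : m < μ := by
        rcases hm with rfl | ⟨i, hi, rfl⟩
        · linarith
        · exact hi.2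
      have hm0 : μ / 2 ≤ m := hmax' _ (Set.mem_insert _ _)
      have : a n ≤ m := by
        refine Real.sSup_le (fun x hx => ?_) (by linarith)
        by_contra! hxm
        have hsub : {i | x ≤ r i} ⊆ {i | μ ≤ r i} := fun i hi => by
          by_contra! hlt
          have hi' : x ≤ r i := hi
          have : r i ≤ m := hmax' _ (Set.mem_insert_of_mem _ ⟨i, ⟨by linarith, by simpa using hlt⟩, rfl⟩)
          linarith
        have := Set.ncard_le_ncard hsub (hr.finite_le_of_pos hμ)
        exact absurd hx.2 (by simp only [hM] at hn ⊢; omega)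
      linarith
    · intro h
      refine le_csSup ⟨∑' i, r i, fun x hx => ?_⟩ ⟨hμ, h⟩
      obtain ⟨i, hi⟩ := Set.nonempty_of_ncard_ne_zero (by have := hx.2; simp only [hM] at this; omega :
        {i | x ≤ r i}.ncard ≠ 0)
      exact le_trans hi (hr.le_tsum i fun j _ => hr0 j)
  have key' : ∀ n μ, 0 < μ → (μ < a n ↔ n < {i | μ < r i}.ncard) := by
    intro n μ hμ
    have hfin : {i | μ < r i}.Finite := (hr.finite_le_of_pos hμ).subset fun i (hi : μ < r i) => hi.le
    constructor
    · intro h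
      exact ((key n (a n) (hμ.trans h)).1 le_rfl).trans_le
        (Set.ncard_le_ncard (fun i hi => h.trans_le hi) hfin)
    · intro h
      obtain ⟨j, hj, hmin⟩ := hfin.exists_minimalFor r _ (Set.nonempty_of_ncard_ne_zero (by omega))
      have hmin' : ∀ i, μ < r i → r j ≤ r i := fun i hi =>
        (le_total (r j) (r i)).elim id fun h => hmin hi h
      have hj' : μ < r j := hj
      refine hj'.trans_le ((key n (r j) (hμ.trans hj')).2 (h.trans_le ?_))
      exact Set.ncard_le_ncard hmin' (hr.finite_le_of_pos (hμ.trans hj'))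
  have hanti : Antitone a := fun n m hnm => by
    rcases (ha0 m).eq_or_lt with h | h
    · rw [← h]; exact ha0 n
    · exact (key n _ h).2 (hnm.trans_lt ((key m _ h).1 le_rfl))
  have hfib : ∀ μ, 0 < μ → {n | a n = μ}.encard = {i | r i = μ}.encard := by
    intro μ hμ
    have hfin := hr.finite_le_of_pos hμ
    have e1 : {n | a n = μ} = (Finset.Ico {i | μ < r i}.ncard (M μ) : Set ℕ) := by
      ext n
      have h1 := key n μ hμ
      have h2 := key' n μ hμ
      simp only [Set.mem_ofPred_eq, Finset.coe_Ico, Set.mem_Ico]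
      rw [← h1, ← not_lt, ← h2, not_lt]
      exact le_antisymm_iff
    have e2 : {i | r i = μ} = {i | μ ≤ r i} \ {i | μ < r i} := by
      ext i
      simp only [Set.mem_ofPred_eq, Set.mem_sdiff, not_lt]
      rw [le_antisymm_iff, and_comm]
    have hsub : {i | μ < r i} ⊆ {i | μ ≤ r i} := fun i (hi : μ < r i) => hi.le
    have e3 : {i | r i = μ}.ncard = M μ - {i | μ < r i}.ncard := by
      rw [e2, Set.ncard_sdiff hsub (hfin.subset hsub)]
    rw [e1, Set.encard_coe_eq_coe_finsetCard, Nat.card_Ico, ← e3, Set.Finite.cast_ncard_eq]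
    exact hfin.subset fun i hi => le_of_eq (Eq.symm hi)
  refine ⟨a, hanti, ha0, ?_, hfib⟩
  obtain ⟨e, he⟩ := exists_equiv_of_encard_fiber_eq
    (fun μ hμ => (hr.finite_le_of_pos hμ).subset fun i hi => le_of_eq (Eq.symm hi)) hfib
  have h1 : Summable fun i : {n | 0 < a n} => a i := by
    have := e.summable_iff.2 (hr.subtype {i | 0 < r i})
    refine this.congr fun i => ?_
    simp [he]
  refine (Subtype.val_injective.summable_iff fun n hn => ?_).1 h1
  rw [Subtype.range_coe] at hn
  exact le_antisymm (not_lt.1 hn) (ha0 n)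

end Rearrangement

/-! ### Spectral theory of positive trace class operators. -/

section Spectral

variable {K : Type u} [NormedAddCommGroup K] [InnerProductSpace ℂ K]

theorem hasSum_norm_inner_sq {ι : Type*} (b : HilbertBasis ι ℂ K) (x : K) :
    HasSum (fun i => ‖inner ℂ (b i) x‖ ^ 2) (‖x‖ ^ 2) := by
  have h := b.hasSum_inner_mul_inner x x
  rw [inner_self_eq_norm_sq_to_K] at h
  have h2 : ∀ i, inner ℂ x (b i) * inner ℂ (b i) x = ((‖inner ℂ (b i) x‖ ^ 2 : ℝ) : ℂ) := fun i => by
    rw [← inner_conj_symm, RCLike.conj_mul]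
    simp
  simp_rw [h2] at h
  simpa [← Complex.ofReal_pow] using Complex.hasSum_re h

theorem isCompactOperator_partialIdentity_mul {ι : Type*} (b : ι → K) (F : Finset ι)
    (S : K →L[ℂ] K) : IsCompactOperator (partialIdentity b F * S) := by
  have : partialIdentity b F * S ∈ compactOperator (RingHom.id ℂ) K K := by
    rw [partialIdentity, Finset.sum_mul]
    refine Submodule.sum_mem _ fun i _ => ?_
    have h : IsCompactOperator (ContinuousLinearMap.toSpanSingleton ℂ (b i)) :=
      (isCompactOperator_of_locallyCompactSpace_rng (ContinuousLinearMap.toSpanSingleton ℂ (b i)))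
    rw [InnerProductSpace.rankOne_def', ContinuousLinearMap.mul_def,
      ContinuousLinearMap.comp_assoc]
    exact h.comp_clm _
  exact this

/-- Coordinates of an eigenvector vanish wherever `r i ≠ μ`. Summability leaves finitely many other
indices, so the algebraic span of the matching basis vectors is already the whole eigenspace. -/
theorem rank_eigenspace_of_eigenbasis {R : K →L[ℂ] K} (hR : R.IsPositive) {ι : Type u}
    (b : HilbertBasis ι ℂ K) {r : ι → ℝ} (hr : Summable r) (hb : ∀ i, R (b i) = (r i : ℂ) • b i) {μ : ℝ} (hμ : 0 < μ) :
    Cardinal.toENat (Module.rank ℂ (Module.End.eigenspace (R : K →ₗ[ℂ] K) (μ : ℂ))) =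
      {i | r i = μ}.encard := by
  have hfin : {i | r i = μ}.Finite :=
    (hr.finite_le_of_pos hμ).subset fun i hi => le_of_eq (Eq.symm hi)
  let v : {i | r i = μ} → K := fun i => b i
  have hon : Orthonormal ℂ v := b.orthonormal.comp _ Subtype.val_injective
  have hspan : Module.End.eigenspace (R : K →ₗ[ℂ] K) (μ : ℂ) = Submodule.span ℂ (Set.range v) := by
    apply le_antisymm
    · intro x hx
      have hx' : R x = (μ : ℂ) • x := Module.End.mem_eigenspace_iff.1 hx
      have hadj : ∀ i, (r i : ℂ) * b.repr x i = (μ : ℂ) * b.repr x i := by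
        intro i
        rw [b.repr_apply_apply, ← inner_smul_right (b i) x (μ : ℂ), ← hx', ← hR.inner_left_eq_inner_right, hb,
          inner_smul_left, Complex.conj_ofReal]
      have hz : ∀ i, i ∉ hfin.toFinset → b.repr x i • b i = 0 := fun i hi => by
        have hne : r i ≠ μ := by simpa using hi
        have := hadj i
        rw [← sub_eq_zero, ← sub_mul, mul_eq_zero, sub_eq_zero] at this
        rcases this with h | h
        · exact absurd (Complex.ofReal_injective h) hne
        · rw [h, zero_smul]
      rw [(b.hasSum_repr x).unique (hasSum_sum_of_ne_finset_zero hz)]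
      refine Submodule.sum_mem _ fun i hi => Submodule.smul_mem _ _ ?_
      exact Submodule.subset_span ⟨⟨i, by simpa using hi⟩, rfl⟩
    · rw [Submodule.span_le]
      rintro _ ⟨i, rfl⟩
      have : r i = μ := i.2
      rw [SetLike.mem_coe, Module.End.mem_eigenspace_iff, ← this]
      exact hb i
  rw [hspan, rank_span hon.linearIndependent, Cardinal.mk_range_eq _ hon.linearIndependent.injective]
  exact Set.toENat_cardinalMk _

variable [CompleteSpace K]

/-- A self-adjoint Hilbert-Schmidt operator is compact. -/
theorem isCompactOperator_of_summable_norm_sq {ι : Type*} (b : HilbertBasis ι ℂ K) {S : K →L[ℂ] K}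
    (hS : IsSelfAdjoint S) (h : Summable fun i => ‖S (b i)‖ ^ 2) : IsCompactOperator S := by
  classical
  -- For `i ∉ F` the `i`-th coordinate of the error at `x` is, up to sign, `⟨S (b i), x⟩`, since `S`
  -- is self-adjoint; the other coordinates vanish. The tail of the Hilbert-Schmidt sum thus bounds
  -- the operator norm.
  have key : ∀ F, ‖partialIdentity b F * S - S‖ ≤
      √((∑' i, ‖S (b i)‖ ^ 2) - ∑ i ∈ F, ‖S (b i)‖ ^ 2) := by
    intro F
    refine ContinuousLinearMap.opNorm_le_bound _ (Real.sqrt_nonneg _) fun x => ?_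
    have h1 := hasSum_norm_inner_sq b ((partialIdentity b F * S - S) x)
    have h2 : HasSum (fun i => ‖S (b i)‖ ^ 2 - if i ∈ F then ‖S (b i)‖ ^ 2 else 0)
        ((∑' i, ‖S (b i)‖ ^ 2) - ∑ i ∈ F, ‖S (b i)‖ ^ 2) := by
      refine h.hasSum.sub ?_
      have := hasSum_sum_of_ne_finset_zero (s := F) (L := .unconditional ι)
        (f := fun i => if i ∈ F then ‖S (b i)‖ ^ 2 else 0) (fun i hi => if_neg hi)
      rwa [Finset.sum_congr rfl fun i hi => if_pos hi] at this
    have h3 := hasSum_le (fun i => ?_) h1 (h2.mul_right (‖x‖ ^ 2))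
    · rw [← Real.sqrt_sq (norm_nonneg x), ← Real.sqrt_mul' _ (sq_nonneg _)]
      exact Real.le_sqrt_of_sq_le h3
    · have e : inner ℂ (b i) ((partialIdentity b F * S) x) =
          if i ∈ F then inner ℂ (b i) (S x) else 0 := by
        simp [partialIdentity, orthonormal_iff_ite.1 b.orthonormal]
      have e2 : inner ℂ (b i) (S x) = inner ℂ (S (b i)) x := by
        rw [← ContinuousLinearMap.adjoint_inner_left, ← ContinuousLinearMap.star_eq_adjoint, hS]
      rw [sub_apply, inner_sub_right, e]
      split_ifs with hi
      · simp
      · rw [zero_sub, norm_neg, e2, sub_zero, ← mul_pow]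
        gcongr
        exact norm_inner_le_norm _ _
  refine isCompactOperator_of_tendsto (l := atTop) (F := fun F => partialIdentity b F * S) ?_
    (Eventually.of_forall fun F => isCompactOperator_partialIdentity_mul b F S)
  rw [tendsto_iff_norm_sub_tendsto_zero]
  refine squeeze_zero (fun F => norm_nonneg _) key ?_
  have h4 := (h.hasSum.const_sub (∑' i, ‖S (b i)‖ ^ 2)).sqrt
  rwa [sub_self, Real.sqrt_zero] at h4

/-- The square root `S` of `R` is Hilbert-Schmidt because `‖S b‖² = ⟨b, R b⟩`; so `S`, and with it
`R = S S`, is compact. -/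
theorem ContinuousLinearMap.IsPositive.isCompactOperator_of_hasTrace {R : K →L[ℂ] K}
    (hR : R.IsPositive) {z : ℂ} (h : HasTrace R z) : IsCompactOperator R := by
  obtain ⟨w, b, -⟩ := exists_hilbertBasis ℂ K
  have hR' := (ContinuousLinearMap.nonneg_iff_isPositive R).2 hR
  set S := CFC.sqrt R with hS
  have hSS : S * S = R := CFC.sqrt_mul_sqrt_self R
  have hSA : IsSelfAdjoint S := (CFC.sqrt_nonneg R).isSelfAdjoint
  have hsum : Summable fun i => ‖S (b i)‖ ^ 2 := by
    have := (Complex.hasSum_re (h w b)).summable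
    refine this.congr fun i => ?_
    have e : inner ℂ (b i) (R (b i)) = inner ℂ (S (b i)) (S (b i)) := by
      rw [← hSS, ← ContinuousLinearMap.adjoint_inner_right, ← ContinuousLinearMap.star_eq_adjoint,
        hSA]
      rfl
    rw [e, inner_self_eq_norm_sq_to_K]
    norm_cast
  rw [← hSS]
  exact (isCompactOperator_of_summable_norm_sq b hSA hsum).comp_clm S

/-- Hilbert bases of all eigenspaces, the kernel included, are glued together; the spectral theorem
for compact symmetric operators makes the result total. -/
theorem ContinuousLinearMap.IsPositive.exists_eigenbasis {R : K →L[ℂ] K} (hR : R.IsPositive)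
    (hc : IsCompactOperator R) :
    ∃ (ι : Type u) (b : HilbertBasis ι ℂ K) (r : ι → ℝ), (∀ i, 0 ≤ r i) ∧
      ∀ i, R (b i) = (r i : ℂ) • b i := by
  have hsymm : (R : K →ₗ[ℂ] K).IsSymmetric := hR.isSymmetric
  have hcl : ∀ μ : ℂ, CompleteSpace (Module.End.eigenspace (R : K →ₗ[ℂ] K) μ) := fun μ => by
    have : (Module.End.eigenspace (R : K →ₗ[ℂ] K) μ : Set K) = {x | R x = μ • x} := by
      ext x; simp
    have hcl : IsClosed (Module.End.eigenspace (R : K →ₗ[ℂ] K) μ : Set K) := by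
      rw [this]
      exact isClosed_eq R.continuous (continuous_const_smul μ)
    exact hcl.completeSpace_coe
  choose w c hc' using fun μ : ℂ =>
    exists_hilbertBasis ℂ (Module.End.eigenspace (R : K →ₗ[ℂ] K) μ)
  let v : (Σ μ : ℂ, w μ) → K := fun p => (c p.1 p.2 : K)
  have hv : ∀ p, R (v p) = p.1 • v p := fun p => Module.End.mem_eigenspace_iff.1 (c p.1 p.2).2
  have hon : Orthonormal ℂ v := by
    classical
    rw [orthonormal_iff_ite]
    rintro ⟨μ, i⟩ ⟨ν, j⟩
    by_cases hμν : μ = ν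
    · subst hμν
      have := orthonormal_iff_ite.1 (c μ).orthonormal i j
      simpa [v] using this
    · have := hsymm.orthogonalFamily_eigenspaces hμν (c μ i) (c ν j)
      rw [if_neg (by rintro ⟨⟩; exact hμν rfl)]
      exact this
  have hspan : (Submodule.span ℂ (Set.range v))ᗮ = ⊥ := by
    rw [Submodule.eq_bot_iff]
    intro x hx
    have hx' : x ∈ (⨆ μ, Module.End.eigenspace (R : K →ₗ[ℂ] K) μ)ᗮ := by
      rw [← Submodule.iInf_orthogonal, Submodule.mem_iInf]
      intro μ y hy
      have hz : ∀ i, inner ℂ (v ⟨μ, i⟩) x = 0 := fun i =>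
        hx _ (Submodule.subset_span ⟨_, rfl⟩)
      have h1 := (c μ).hasSum_repr ⟨y, hy⟩
      have h2 : HasSum (fun i => (c μ).repr ⟨y, hy⟩ i • v ⟨μ, i⟩) y :=
        h1.mapL (Submodule.subtypeL _)
      have h3 := h2.mapL (innerSL ℂ x)
      have h4 : ∀ i, innerSL ℂ x ((c μ).repr ⟨y, hy⟩ i • v ⟨μ, i⟩) = 0 := fun i => by
        rw [innerSL_apply_apply, inner_smul_right, ← inner_conj_symm, hz i]
        simp
      simp_rw [h4] at h3
      have := h3.unique hasSum_zero
      rw [← inner_conj_symm, ← innerSL_apply_apply ℂ x y, this, map_zero]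
    rwa [ContinuousLinearMap.orthogonalComplement_iSup_eigenspaces_eq_bot hc hsymm] at hx'
  refine ⟨_, HilbertBasis.mkOfOrthogonalEqBot hon hspan, fun p => p.1.re, fun p => ?_, fun p => ?_⟩
  · have h := hR.inner_nonneg_right (v p)
    rw [hv, inner_smul_right, inner_self_eq_norm_sq_to_K, hon.1] at h
    simpa using (Complex.le_def.1 h).1
  · rw [HilbertBasis.coe_mkOfOrthogonalEqBot, hv]
    congr 1
    have h := hR.inner_nonneg_right (v p)
    rw [hv, inner_smul_right, inner_self_eq_norm_sq_to_K, hon.1] at h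
    refine Complex.ext rfl ?_
    simpa using (Complex.le_def.1 h).2.symm

theorem IsDensityOperator.exists_eigenbasis {R : K →L[ℂ] K} {φ : (K →L[ℂ] K) → ℂ}
    (h : IsDensityOperator R φ) :
    ∃ (ι : Type u) (b : HilbertBasis ι ℂ K) (r : ι → ℝ), (∀ i, 0 ≤ r i) ∧ Summable r ∧
      (∀ i, R (b i) = (r i : ℂ) • b i) ∧
      ∀ T : K →L[ℂ] K, HasSum (fun i => (r i : ℂ) * inner ℂ (b i) (T (b i))) (φ T) := by
  have htr : HasTrace R (φ 1) := h.hasTrace 1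
  obtain ⟨ι, b, r, hr, hb⟩ :=
    h.isPositive.exists_eigenbasis (h.isPositive.isCompactOperator_of_hasTrace htr)
  have hsum : ∀ T : K →L[ℂ] K, HasSum (fun i => (r i : ℂ) * inner ℂ (b i) (T (b i))) (φ T) := by
    intro T
    refine (h.hasTrace T ι b).congr_fun fun i => ?_
    rw [ContinuousLinearMap.comp_apply, ← h.isPositive.inner_left_eq_inner_right, hb,
      inner_smul_left, Complex.conj_ofReal]
  refine ⟨ι, b, r, hr, ?_, hb, hsum⟩
  refine (Complex.hasSum_re (hsum 1)).summable.congr fun i => ?_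
  rw [one_apply_eq_self, inner_self_eq_norm_sq_to_K, b.orthonormal.1]
  simp

theorem IsDensityOperator.exists_isOperatorEigenvalueList {R : K →L[ℂ] K} {φ : (K →L[ℂ] K) → ℂ}
    (h : IsDensityOperator R φ) : ∃ a, IsOperatorEigenvalueList R a := by
  obtain ⟨ι, b, r, hr0, hr, hb, -⟩ := h.exists_eigenbasis
  obtain ⟨a, ha, ha0, has, hm⟩ := exists_antitone_rearrangement hr hr0
  exact ⟨a, ha, ha0, has, fun μ hμ => by
    rw [hm μ hμ, rank_eigenspace_of_eigenbasis h.isPositive b hr hb hμ]⟩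

/-- The spectral resolution of a normal functional along the eigenvalue list of its density
operator. The vectors `f n` with `a n = 0` vanish. -/
theorem IsDensityOperator.exists_resolution {R : K →L[ℂ] K} {φ : (K →L[ℂ] K) → ℂ}
    (h : IsDensityOperator R φ) {a : ℕ → ℝ} (ha : IsOperatorEigenvalueList R a) :
    ∃ f : ℕ → K, (∀ m n, inner ℂ (f m) (f n) = if m = n ∧ 0 < a m then 1 else 0) ∧
      ∀ T : K →L[ℂ] K, HasSum (fun n => (a n : ℂ) * inner ℂ (f n) (T (f n))) (φ T) := by
  classical
  obtain ⟨ι, b, r, hr0, hr, hb, hφ⟩ := h.exists_eigenbasis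
  obtain ⟨e, he⟩ := exists_equiv_of_encard_fiber_eq (a := a) (r := r)
    (fun μ hμ => (hr.finite_le_of_pos hμ).subset fun i hi => le_of_eq (Eq.symm hi))
    (fun μ hμ => by rw [ha.multiplicity μ hμ, rank_eigenspace_of_eigenbasis h.isPositive b hr hb hμ])
  refine ⟨fun n => if hn : 0 < a n then b (e ⟨n, hn⟩) else 0, fun m n => ?_, fun T => ?_⟩
  · by_cases hm : 0 < a m
    · by_cases hn : 0 < a n
      · simp only [hm, hn, dif_pos, orthonormal_iff_ite.1 b.orthonormal, and_true]
        congr 1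
        rw [Subtype.val_injective.eq_iff, e.injective.eq_iff, Subtype.mk_eq_mk]
      · have : m ≠ n := by rintro rfl; exact hn hm
        simp [hn, this]
    · simp [hm]
  · have h1 : HasSum (fun i : {i | 0 < r i} => (r i : ℂ) * inner ℂ (b i) (T (b i))) (φ T) := by
      refine (Subtype.val_injective.hasSum_iff fun i hi => ?_).2 (hφ T)
      rw [Subtype.range_coe] at hi
      rw [le_antisymm (not_lt.1 hi) (hr0 i)]
      simp
    have h2 := e.hasSum_iff.2 h1
    refine (Subtype.val_injective.hasSum_iff fun n hn => ?_).1 (h2.congr_fun fun n => ?_)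
    · rw [Subtype.range_coe] at hn
      rw [le_antisymm (not_lt.1 hn) (ha.nonneg n)]
      simp
    · have hn : 0 < a n := n.2
      simp [he, hn]

end Spectral

/-! ### The Ky Fan maximum principle. -/

section KyFan

/-- Bathtub principle: weights in `[0, C]` of total mass at most `n C` do best by sitting with full
weight on the `n` largest `a m`. The comparison is termwise, `a m c m ≤ a n c m + (a m - a n) C` for
`m < n` and `a m c m ≤ a n c m` beyond. -/
theorem tsum_mul_le_of_antitone {a c : ℕ → ℝ} (ha : Antitone a) (ha0 : ∀ m, 0 ≤ a m) {C : ℝ}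
    (hc0 : ∀ m, 0 ≤ c m) (hcC : ∀ m, c m ≤ C) (hc : Summable c) (n : ℕ) (hn : ∑' m, c m ≤ n * C) :
    Summable (fun m => a m * c m) ∧ ∑' m, a m * c m ≤ C * ∑ m ∈ Finset.range n, a m := by
  have hs : Summable (fun m => a m * c m) :=
    Summable.of_nonneg_of_le (fun m => mul_nonneg (ha0 m) (hc0 m))
      (fun m => mul_le_mul_of_nonneg_right (ha (Nat.zero_le m)) (hc0 m)) (hc.mul_left (a 0))
  refine ⟨hs, ?_⟩
  have h1 : HasSum (fun m => if m ∈ Finset.range n then (a m - a n) * C else 0)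
      (∑ m ∈ Finset.range n, (a m - a n) * C) := by
    have := hasSum_sum_of_ne_finset_zero (s := Finset.range n) (L := .unconditional ℕ)
      (f := fun m => if m ∈ Finset.range n then (a m - a n) * C else 0) (fun m hm => if_neg hm)
    rwa [Finset.sum_congr rfl fun m hm => if_pos hm] at this
  have h2 := hasSum_le (fun m => ?_) hs.hasSum ((hc.hasSum.mul_left (a n)).add h1)
  · calc ∑' m, a m * c m ≤ a n * ∑' m, c m + ∑ m ∈ Finset.range n, (a m - a n) * C := h2
      _ ≤ a n * (n * C) + ∑ m ∈ Finset.range n, (a m - a n) * C := by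
        gcongr; exact ha0 n
      _ = C * ∑ m ∈ Finset.range n, a m := by
        rw [← Finset.sum_mul, Finset.sum_sub_distrib, Finset.sum_const, Finset.card_range,
          nsmul_eq_mul]
        ring
  · split_ifs with hm
    · have : a n ≤ a m := ha (Finset.mem_range.1 hm).le
      nlinarith [mul_le_mul_of_nonneg_left (hcC m) (sub_nonneg.2 this)]
    · have : a m ≤ a n := ha (by simpa using hm)
      simpa using mul_le_mul_of_nonneg_right this (hc0 m)

variable {K : Type*} [NormedAddCommGroup K] [InnerProductSpace ℂ K]

/-- A Bessel inequality for almost orthonormal vectors. -/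
theorem sum_norm_inner_sq_le {κ : Type*} [DecidableEq κ] (A : Finset κ) (u : κ → K) (x : K) :
    ∑ k ∈ A, ‖inner ℂ (u k) x‖ ^ 2 ≤
      (1 + ∑ k ∈ A, ∑ l ∈ A, ‖inner ℂ (u k) (u l) - if k = l then 1 else 0‖) * ‖x‖ ^ 2 := by
  set S := ∑ k ∈ A, ‖inner ℂ (u k) x‖ ^ 2 with hS
  set D := ∑ k ∈ A, ∑ l ∈ A, ‖inner ℂ (u k) (u l) - if k = l then 1 else 0‖ with hD
  -- With this `y` one has `S = ⟨y, x⟩ ≤ ‖y‖ ‖x‖` and `‖y‖² ≤ S (1 + D)`; squaring the first and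
  -- cancelling `S` gives the claim.
  set y := ∑ k ∈ A, inner ℂ (u k) x • u k with hy
  have hS0 : 0 ≤ S := Finset.sum_nonneg fun k _ => by positivity
  have hD0 : 0 ≤ D := Finset.sum_nonneg fun k _ => Finset.sum_nonneg fun l _ => norm_nonneg _
  have h1 : inner ℂ y x = (S : ℂ) := by
    simp only [hy, sum_inner, inner_smul_left, RCLike.conj_mul, hS]
    push_cast
    rfl
  have h2 : inner ℂ y y = (S : ℂ) + ∑ k ∈ A, ∑ l ∈ A, starRingEnd ℂ (inner ℂ (u k) x) *
      (inner ℂ (u l) x * (inner ℂ (u k) (u l) - if k = l then 1 else 0)) := by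
    have e : ∀ k ∈ A, ∑ l ∈ A, starRingEnd ℂ (inner ℂ (u k) x) *
        (inner ℂ (u l) x * if k = l then 1 else 0) = ((‖inner ℂ (u k) x‖ ^ 2 : ℝ) : ℂ) := by
      intro k hk
      simp only [mul_ite, mul_one, mul_zero, Finset.sum_ite_eq, hk, if_true, RCLike.conj_mul]
      push_cast
      rfl
    simp only [mul_sub, Finset.sum_sub_distrib]
    rw [Finset.sum_congr rfl e, hS, Complex.ofReal_sum, add_sub_cancel]
    simp only [hy, sum_inner, inner_sum, inner_smul_left, inner_smul_right, Finset.mul_sum]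
    rw [Finset.sum_comm]
    exact Finset.sum_congr rfl fun k _ => Finset.sum_congr rfl fun l _ => by ring
  have h3 : ‖y‖ ^ 2 ≤ S * (1 + D) := by
    have e : (‖y‖ ^ 2 : ℝ) = ‖inner ℂ y y‖ := by
      rw [inner_self_eq_norm_sq_to_K]; simp
    rw [e, h2, mul_add, mul_one, hD, Finset.mul_sum]
    refine (norm_add_le _ _).trans (add_le_add (by simp [abs_of_nonneg hS0]) ?_)
    refine (norm_sum_le _ _).trans (Finset.sum_le_sum fun k hk => ?_)
    rw [Finset.mul_sum]
    refine (norm_sum_le _ _).trans (Finset.sum_le_sum fun l hl => ?_)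
    rw [norm_mul, norm_mul, RCLike.norm_conj, ← mul_assoc]
    refine mul_le_mul_of_nonneg_right ?_ (norm_nonneg _)
    have hk' : ‖inner ℂ (u k) x‖ ^ 2 ≤ S :=
      Finset.single_le_sum (f := fun k => ‖inner ℂ (u k) x‖ ^ 2) (fun i _ => by positivity) hk
    have hl' : ‖inner ℂ (u l) x‖ ^ 2 ≤ S :=
      Finset.single_le_sum (f := fun k => ‖inner ℂ (u k) x‖ ^ 2) (fun i _ => by positivity) hl
    nlinarith [sq_nonneg (‖inner ℂ (u k) x‖ - ‖inner ℂ (u l) x‖)]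
  have h4 : S ≤ ‖y‖ * ‖x‖ := by
    have := norm_inner_le_norm (𝕜 := ℂ) y x
    rwa [h1, Complex.norm_real, Real.norm_of_nonneg hS0] at this
  rcases hS0.eq_or_lt with h | h
  · rw [← h]; positivity
  · refine le_of_mul_le_mul_left ?_ h
    calc S * S ≤ (‖y‖ * ‖x‖) * (‖y‖ * ‖x‖) := mul_self_le_mul_self hS0 h4
      _ = ‖y‖ ^ 2 * ‖x‖ ^ 2 := by ring
      _ ≤ S * (1 + D) * ‖x‖ ^ 2 := by gcongr
      _ = _ := by ring

theorem bessel_of_gram {κ : Type*} [DecidableEq κ] {f : κ → K} {p : κ → Prop} [DecidablePred p]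
    (hf : ∀ m n, inner ℂ (f m) (f n) = if m = n ∧ p m then 1 else 0) (A : Finset κ) (x : K) :
    ∑ k ∈ A, ‖inner ℂ (f k) x‖ ^ 2 ≤ ‖x‖ ^ 2 := by
  have h0 : ∀ k, ¬ p k → f k = 0 := fun k hk => by
    rw [← inner_self_eq_zero (𝕜 := ℂ), hf]; simp [hk]
  have h1 : ∑ k ∈ A, ‖inner ℂ (f k) x‖ ^ 2 = ∑ k ∈ A with p k, ‖inner ℂ (f k) x‖ ^ 2 := by
    rw [Finset.sum_filter]
    refine Finset.sum_congr rfl fun k _ => ?_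
    split_ifs with hk
    · rfl
    · simp [h0 k hk]
  rw [h1]
  refine (sum_norm_inner_sq_le _ f x).trans_eq ?_
  rw [Finset.sum_eq_zero fun k hk => Finset.sum_eq_zero fun l _ => ?_]
  · simp
  · simp [hf, (Finset.mem_filter.1 hk).2]

/-- A diagonalization of a functional on `B(K)`, with weights in decreasing order. -/
structure IsResolution (φ : (K →L[ℂ] K) → ℂ) (a : ℕ → ℝ) (f : ℕ → K) : Prop where
  antitone : Antitone a
  nonneg : ∀ n, 0 ≤ a n
  gram : ∀ m n, inner ℂ (f m) (f n) = if m = n ∧ 0 < a m then 1 else 0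
  hasSum : ∀ T : K →L[ℂ] K, HasSum (fun n => (a n : ℂ) * inner ℂ (f n) (T (f n))) (φ T)

namespace IsResolution

variable {φ : (K →L[ℂ] K) → ℂ} {a : ℕ → ℝ} {f : ℕ → K}

theorem norm_le_one (h : IsResolution φ a f) (m : ℕ) : ‖f m‖ ^ 2 ≤ 1 := by
  have := inner_self_eq_norm_sq_to_K (𝕜 := ℂ) (f m)
  rw [h.gram] at this
  have h2 : ((‖f m‖ ^ 2 : ℝ) : ℂ) = ((if 0 < a m then 1 else 0 : ℝ) : ℂ) := by
    push_cast
    rw [← Complex.coe_algebraMap] at *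
    simpa using this.symm
  rw [Complex.ofReal_inj.1 h2]
  split_ifs <;> norm_num

theorem mul_norm_sq (h : IsResolution φ a f) (m : ℕ) : (a m : ℂ) * inner ℂ (f m) (f m) = a m := by
  rw [h.gram]
  rcases (h.nonneg m).eq_or_lt with h0 | h0
  · simp [← h0]
  · simp [h0]

theorem hasSum_weights (h : IsResolution φ a f) : HasSum (fun n => (a n : ℂ)) (φ 1) := by
  exact (h.hasSum 1).congr_fun fun n => (h.mul_norm_sq n).symm

theorem hasSum_rankOne (h : IsResolution φ a f) (u : K) :
    HasSum (fun n => a n * ‖inner ℂ (f n) u‖ ^ 2) (φ (rankOne ℂ u u)).re := by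
  refine (Complex.hasSum_re (h.hasSum (rankOne ℂ u u))).congr_fun fun n => ?_
  rw [rankOne_apply, inner_smul_right, ← inner_conj_symm u (f n), RCLike.conj_mul, RCLike.ofReal_eq_complex_ofReal,
    ← Complex.ofReal_pow, ← Complex.ofReal_mul, Complex.ofReal_re]

theorem apply_rankOne (h : IsResolution φ a f) (k : ℕ) :
    (φ (rankOne ℂ (f k) (f k))).re = a k := by
  refine (h.hasSum_rankOne (f k)).unique ((hasSum_ite_eq k (a k)).congr_fun fun n => ?_)
  rw [h.gram]
  split_ifs with h1 h2 h2
  · simp [h2]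
  · exact absurd h1.1 h2
  · subst h2
    have : a n = 0 := le_antisymm (not_lt.1 fun h0 => h1 ⟨rfl, h0⟩) (h.nonneg n)
    simp [this]
  · simp

/-- The Ky Fan maximum principle, for almost orthonormal test vectors. -/
theorem sum_rankOne_le (h : IsResolution φ a f) {κ : Type*} (A : Finset κ) (u : κ → K) {C : ℝ}
    (hC : ∀ x, ∑ k ∈ A, ‖inner ℂ (u k) x‖ ^ 2 ≤ C * ‖x‖ ^ 2) (hC0 : 0 ≤ C) {n : ℕ}
    (hn : A.card ≤ n) :
    ∑ k ∈ A, (φ (rankOne ℂ (u k) (u k))).re ≤ C * ∑ m ∈ Finset.range n, a m := by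
  -- The Bessel bound at `x = u k` yields `‖u k‖² ≤ C`; summed over `A`, this bounds the total mass
  -- in the bathtub principle by `n C`.
  have hu : ∀ k ∈ A, ‖u k‖ ^ 2 ≤ C := by
    intro k hk
    have h1 : ‖inner ℂ (u k) (u k)‖ ^ 2 ≤ C * ‖u k‖ ^ 2 :=
      (Finset.single_le_sum (f := fun l => ‖inner ℂ (u l) (u k)‖ ^ 2)
        (fun i _ => by positivity) hk).trans (hC (u k))
    rw [inner_self_eq_norm_sq_to_K, norm_pow, RCLike.norm_ofReal, abs_norm] at h1
    rcases (norm_nonneg (u k)).eq_or_lt with h0 | h0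
    · rw [← h0]; simpa using hC0
    · have : 0 < ‖u k‖ ^ 2 := by positivity
      nlinarith
  have hb : ∀ k, Summable (fun m => ‖inner ℂ (f m) (u k)‖ ^ 2) ∧
      ∑' m, ‖inner ℂ (f m) (u k)‖ ^ 2 ≤ ‖u k‖ ^ 2 := fun k => by
    have hs := summable_of_sum_le (fun m => by positivity) fun s => bessel_of_gram h.gram s (u k)
    exact ⟨hs, hs.tsum_le_of_sum_le fun s => bessel_of_gram h.gram s (u k)⟩
  have hsum : HasSum (fun m => ∑ k ∈ A, ‖inner ℂ (f m) (u k)‖ ^ 2)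
      (∑ k ∈ A, ∑' m, ‖inner ℂ (f m) (u k)‖ ^ 2) := hasSum_sum fun k _ => (hb k).1.hasSum
  obtain ⟨-, h2⟩ := tsum_mul_le_of_antitone h.antitone h.nonneg (C := C)
    (c := fun m => ∑ k ∈ A, ‖inner ℂ (f m) (u k)‖ ^ 2)
    (fun m => Finset.sum_nonneg fun k _ => by positivity)
    (fun m => by
      simp_rw [norm_inner_symm (f m)]
      refine (hC (f m)).trans ?_
      nlinarith [h.norm_le_one m])
    hsum.summable n (by
      rw [hsum.tsum_eq]
      calc ∑ k ∈ A, ∑' m, ‖inner ℂ (f m) (u k)‖ ^ 2 ≤ ∑ k ∈ A, C :=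
            Finset.sum_le_sum fun k hk => (hb k).2.trans (hu k hk)
        _ = A.card * C := by rw [Finset.sum_const, nsmul_eq_mul]
        _ ≤ n * C := by gcongr)
  have h3 : HasSum (fun m => a m * ∑ k ∈ A, ‖inner ℂ (f m) (u k)‖ ^ 2)
      (∑ k ∈ A, (φ (rankOne ℂ (u k) (u k))).re) := by
    simp_rw [Finset.mul_sum]
    exact hasSum_sum fun k _ => h.hasSum_rankOne (u k)
  rwa [h3.tsum_eq] at h2

end IsResolution

theorem IsDensityOperator.exists_isResolution {K : Type u} [NormedAddCommGroup K]
    [InnerProductSpace ℂ K] [CompleteSpace K] {R : K →L[ℂ] K} {φ : (K →L[ℂ] K) → ℂ}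
    (h : IsDensityOperator R φ) {a : ℕ → ℝ} (ha : IsOperatorEigenvalueList R a) :
    ∃ f : ℕ → K, IsResolution φ a f := by
  obtain ⟨f, hf, hφ⟩ := h.exists_resolution ha
  exact ⟨f, ha.antitone, ha.nonneg, hf, hφ⟩

end KyFan

/-! ### Independence of the eigenvalue list from the representation. -/

section Uniqueness

variable {K K' : Type*} [NormedAddCommGroup K] [InnerProductSpace ℂ K] [CompleteSpace K]
  [NormedAddCommGroup K'] [InnerProductSpace ℂ K'] [CompleteSpace K']

/-- Isomorphisms map rank one projections, being minimal, to rank one projections. -/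
theorem exists_map_rankOne_eq (ψ : (K →L[ℂ] K) ≃⋆ₐ[ℂ] (K' →L[ℂ] K')) {f : K} (hf : ‖f‖ = 1) :
    ∃ u : K', ‖u‖ = 1 ∧ ψ (rankOne ℂ f f) = rankOne ℂ u u := by
  have hf0 : f ≠ 0 := by rintro rfl; simp at hf
  have hff : inner ℂ f f = 1 := by rw [inner_self_eq_norm_sq_to_K, hf]; simp
  set p := rankOne ℂ f f with hp
  have hpp : p * p = p := by rw [hp, rankOne_mul_rankOne, hff, one_smul]
  have hp0 : ψ p ≠ 0 := by
    rw [Ne, map_eq_zero_iff ψ ψ.injective]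
    exact rankOne_ne_zero hf0 hf0
  have hq : ψ p * ψ p = ψ p := by rw [← map_mul, hpp]
  have hqs : star (ψ p) = ψ p := by
    have : ψ (star p) = star (ψ p) := ψ.map_star' p
    rw [hp, star_rankOne] at this
    exact this.symm
  obtain ⟨x, hx⟩ : ∃ x, ψ p x ≠ 0 := by
    by_contra! h
    exact hp0 (ContinuousLinearMap.ext h)
  set g : K' := (‖ψ p x‖⁻¹ : ℂ) • ψ p x with hg
  have hg1 : ‖g‖ = 1 := by
    rw [hg, norm_smul, norm_inv, Complex.norm_real, norm_norm, inv_mul_cancel₀ (norm_ne_zero_iff.2 hx)]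
  have hgg : inner ℂ g g = 1 := by rw [inner_self_eq_norm_sq_to_K, hg1]; simp
  have hqg : ψ p g = g := by
    have h := congrArg (fun T => T x) hq
    rw [hg, map_smul]
    exact congrArg _ h
  have h1 : ψ p * rankOne ℂ g g * ψ p = rankOne ℂ g g := by
    ext y
    have : inner ℂ g (ψ p y) = inner ℂ g y := by
      rw [← ContinuousLinearMap.adjoint_inner_left, ← ContinuousLinearMap.star_eq_adjoint, hqs, hqg]
    simp [this, hqg]
  -- Minimality of `p`: the compression of any operator is a multiple of `p`. Applied to the
  -- preimage of `|g⟩⟨g|`, which lies under `ψ p`, it makes `|g⟩⟨g|` a multiple of `ψ p`; evaluation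
  -- at `g` shows the factor to be one.
  have h2 : ∀ T : K →L[ℂ] K, p * T * p = inner ℂ f (T f) • p := fun T => by
    ext y
    simp [hp, smul_smul]
    ring_nf
  have h3 : ∃ c : ℂ, c • ψ p = rankOne ℂ g g := by
    refine ⟨inner ℂ f (ψ.symm (rankOne ℂ g g) f), ?_⟩
    rw [← map_smul, ← h2, map_mul, map_mul, StarAlgEquiv.apply_symm_apply, h1]
  obtain ⟨c, hc⟩ := h3
  have h4 := congrArg (fun T => T g) hc
  simp only [smul_apply, hqg, rankOne_apply, hgg, one_smul] at h4
  have hc1 : c = 1 := by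
    have h5 := congrArg (inner ℂ g) h4
    rwa [inner_smul_right, hgg, mul_one] at h5
  exact ⟨g, hg1, by rw [← hc, hc1, one_smul]⟩

/-- The isomorphism carries the rank one eigenprojections of `φ` to mutually orthogonal rank one
projections on `K'`, which are test vectors for the Ky Fan principle of `φ'`. -/
theorem IsResolution.sum_range_le {φ : (K →L[ℂ] K) → ℂ} {φ' : (K' →L[ℂ] K') → ℂ} {a a' : ℕ → ℝ}
    {f : ℕ → K} {f' : ℕ → K'} (h : IsResolution φ a f) (h' : IsResolution φ' a' f')
    (ψ : (K →L[ℂ] K) ≃⋆ₐ[ℂ] (K' →L[ℂ] K')) (hψ : ∀ T, φ' (ψ T) = φ T) (n : ℕ) :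
    ∑ m ∈ Finset.range n, a m ≤ ∑ m ∈ Finset.range n, a' m := by
  have hu : ∀ k, ∃ u : K', inner ℂ u u = (if 0 < a k then 1 else 0 : ℂ) ∧
      ψ (rankOne ℂ (f k) (f k)) = rankOne ℂ u u := fun k => by
    by_cases hk : 0 < a k
    · have h1 : ‖f k‖ = 1 := by
        have := h.gram k k
        rw [inner_self_eq_norm_sq_to_K] at this
        have h2 : ‖f k‖ ^ 2 = 1 := by
          simp only [hk, and_self, if_true] at this
          exact Complex.ofReal_injective (by simpa using this)
        exact (pow_eq_one_iff_of_nonneg (norm_nonneg _) two_ne_zero).1 h2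
      obtain ⟨u, hu, he⟩ := exists_map_rankOne_eq ψ h1
      exact ⟨u, by rw [inner_self_eq_norm_sq_to_K, hu]; simp [hk], he⟩
    · have h1 : f k = 0 := by
        rw [← inner_self_eq_zero (𝕜 := ℂ), h.gram]; simp [hk]
      exact ⟨0, by simp [hk], by simp [h1]⟩
  choose u hu1 hu2 using hu
  have hgram : ∀ m n, inner ℂ (u m) (u n) = if m = n ∧ 0 < a m then 1 else 0 := by
    intro k l
    by_cases hkl : k = l
    · subst hkl; rw [hu1]; simp
    · have h1 : rankOne ℂ (u k) (u k) * rankOne ℂ (u l) (u l) = 0 := by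
        rw [← hu2, ← hu2, ← map_mul, rankOne_mul_rankOne, h.gram]
        simp [hkl]
      rw [rankOne_mul_rankOne, smul_eq_zero, rankOne_eq_zero] at h1
      rw [if_neg (by tauto)]
      rcases h1 with h1 | h1 | h1
      · exact h1
      · simp [h1]
      · simp [h1]
  have := h'.sum_rankOne_le (Finset.range n) u (C := 1) (fun x => by
    rw [one_mul]; exact bessel_of_gram hgram _ x) zero_le_one (n := n) (by simp)
  rw [one_mul] at this
  refine le_trans (le_of_eq (Finset.sum_congr rfl fun k _ => ?_)) this
  rw [← hu2, hψ, h.apply_rankOne]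

theorem eq_of_sum_range_eq {a a' : ℕ → ℝ}
    (h : ∀ n, ∑ m ∈ Finset.range n, a m = ∑ m ∈ Finset.range n, a' m) : a = a' := by
  funext n
  have := h (n + 1)
  rw [Finset.sum_range_succ, Finset.sum_range_succ, h n] at this
  linarith

end Uniqueness

/-- The eigenvalue list of a normal state of a type I factor is unique. -/
theorem IsEigenvalueList.eq {M : Type u} [Ring M] [StarRing M] [Algebra ℂ M]
    {φ : M →ₗ[ℂ] ℂ} {a a' : ℕ → ℝ} (h : IsEigenvalueList φ a) (h' : IsEigenvalueList φ a') :
    a = a' := by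
  obtain ⟨K, _, _, _, θ, R, hR, hRa⟩ := h
  obtain ⟨K', _, _, _, θ', R', hR', hRa'⟩ := h'
  obtain ⟨f, hf⟩ := hR.exists_isResolution hRa
  obtain ⟨f', hf'⟩ := hR'.exists_isResolution hRa'
  refine eq_of_sum_range_eq fun n => le_antisymm ?_ ?_
  · exact hf.sum_range_le hf' (θ.trans θ'.symm) (fun T => by simp) n
  · exact hf'.sum_range_le hf (θ'.trans θ.symm) (fun T => by simp) n

/-! ### Convergence of eigenvalue lists from convergence of Gram matrices. -/

section Convergence

/-- The deviation from orthonormality of the vectors `w m / √(δ m)` with `m < N` and `0 < δ m`. -/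
noncomputable def gramError {K : Type*} [NormedAddCommGroup K] [InnerProductSpace ℂ K]
    (δ : ℕ → ℝ) (w : ℕ → K) (N : ℕ) : ℝ :=
  ∑ m ∈ Finset.range N with 0 < δ m, ∑ n ∈ Finset.range N with 0 < δ n,
    ‖inner ℂ (((√(δ m))⁻¹ : ℂ) • w m) (((√(δ n))⁻¹ : ℂ) • w n) - if m = n then 1 else 0‖

theorem gramError_nonneg {K : Type*} [NormedAddCommGroup K] [InnerProductSpace ℂ K]
    (δ : ℕ → ℝ) (w : ℕ → K) (N : ℕ) : 0 ≤ gramError δ w N :=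
  Finset.sum_nonneg fun _ _ => Finset.sum_nonneg fun _ _ => norm_nonneg _

theorem tendsto_gramError {T : Type*} {l : Filter T} {K : T → Type*}
    [∀ t, NormedAddCommGroup (K t)] [∀ t, InnerProductSpace ℂ (K t)] {δ : ℕ → ℝ} {w : ∀ t, ℕ → K t}
    (hw : ∀ m n, Tendsto (fun t => inner ℂ (w t m) (w t n)) l
      (𝓝 (if m = n then (δ m : ℂ) else 0))) (N : ℕ) :
    Tendsto (fun t => gramError δ (w t) N) l (𝓝 0) := by
  have h : ∀ m ∈ (Finset.range N).filter (0 < δ ·), ∀ n ∈ (Finset.range N).filter (0 < δ ·),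
      Tendsto (fun t => ‖inner ℂ (((√(δ m))⁻¹ : ℂ) • w t m) (((√(δ n))⁻¹ : ℂ) • w t n)
        - if m = n then 1 else 0‖) l (𝓝 0) := by
    intro m hm n hn
    have hm0 : 0 < δ m := (Finset.mem_filter.1 hm).2
    have h1 := (((hw m n).const_mul (√(δ n) : ℂ)⁻¹).const_mul
      (starRingEnd ℂ (√(δ m) : ℂ)⁻¹)).sub_const (if m = n then (1 : ℂ) else 0)
    have h2 : starRingEnd ℂ (√(δ m) : ℂ)⁻¹ * ((√(δ n) : ℂ)⁻¹ * if m = n then (δ m : ℂ) else 0)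
        - (if m = n then 1 else 0) = 0 := by
      split_ifs with hmn
      · subst hmn
        have h3 : (√(δ m) : ℂ) * √(δ m) = δ m := by
          rw [← Complex.ofReal_mul, Real.mul_self_sqrt hm0.le]
        have h4 : (√(δ m) : ℂ) ≠ 0 := by
          simpa using (Real.sqrt_pos.2 hm0).ne'
        rw [map_inv₀, Complex.conj_ofReal, ← h3]
        field_simp
        simp
      · simp
    rw [h2] at h1
    have h5 := h1.norm
    rw [norm_zero] at h5
    refine h5.congr fun t => ?_
    rw [inner_smul_left, inner_smul_right]
  have := tendsto_finsetSum _ fun m hm => tendsto_finsetSum _ fun n hn => h m hm n hn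
  simpa [gramError] using this

variable {K : Type*} [NormedAddCommGroup K] [InnerProductSpace ℂ K]

theorem inner_rankOne_self (u x : K) :
    inner ℂ x (InnerProductSpace.rankOne ℂ u u x) = ((‖inner ℂ u x‖ ^ 2 : ℝ) : ℂ) := by
  rw [InnerProductSpace.rankOne_apply, inner_smul_right, ← inner_conj_symm x u, RCLike.mul_conj]
  simp

theorem inner_partialIdentity_self {ι : Type*} (f : ι → K) (F : Finset ι) (x : K) :
    inner ℂ x (partialIdentity f F x) = ((∑ k ∈ F, ‖inner ℂ (f k) x‖ ^ 2 : ℝ) : ℂ) := by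
  simp only [partialIdentity, sum_apply, inner_sum, inner_rankOne_self, Complex.ofReal_sum]

variable {φ : (K →L[ℂ] K) →ₗ[ℂ] ℂ} {a : ℕ → ℝ} {f : ℕ → K} {δ : ℕ → ℝ} {w : ℕ → K}

/-- Lower bound for the eigenvalue sums: Ky Fan is applied to `u m = w m / √(δ m)`, and `φ(|u m⟩⟨u
m|)` is at least the single term `|⟨u m, w m⟩|² = ‖w m‖⁴ / δ m`. When `‖w m‖²` is near `δ m`, so is
this term. -/
theorem IsResolution.sum_norm_pow_four_div_le (h : IsResolution φ a f)
    (hdom : ∀ X : K →L[ℂ] K, X.IsPositive → ∀ N,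
      ∑ n ∈ Finset.range N, (inner ℂ (w n) (X (w n))).re ≤ (φ X).re) (n : ℕ) :
    ∑ m ∈ Finset.range n with 0 < δ m, ‖w m‖ ^ 4 / δ m ≤
      (1 + gramError δ w n) * ∑ m ∈ Finset.range n, a m := by
  refine le_trans (Finset.sum_le_sum fun m hm => ?_)
    (h.sum_rankOne_le ((Finset.range n).filter (0 < δ ·)) (fun m => ((√(δ m))⁻¹ : ℂ) • w m)
      (fun x => sum_norm_inner_sq_le _ _ x)
      (add_nonneg zero_le_one (gramError_nonneg δ w n)) (by simpa using Finset.card_filter_le (Finset.range n) _))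
  have hm0 : 0 < δ m := (Finset.mem_filter.1 hm).2
  set u := ((√(δ m))⁻¹ : ℂ) • w m with hu
  have h1 := hdom (rankOne ℂ u u) (isPositive_rankOne_self u) (m + 1)
  have h2 : (inner ℂ (w m) (rankOne ℂ u u (w m))).re ≤
      ∑ n ∈ Finset.range (m + 1), (inner ℂ (w n) (rankOne ℂ u u (w n))).re :=
    Finset.single_le_sum (f := fun n => (inner ℂ (w n) (rankOne ℂ u u (w n))).re)
      (fun i _ => by rw [inner_rankOne_self, Complex.ofReal_re]; positivity) (by simp)
  refine le_trans (le_of_eq ?_) (h2.trans h1)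
  rw [inner_rankOne_self, Complex.ofReal_re, hu, inner_smul_left, norm_mul, RCLike.norm_conj,
    inner_self_eq_norm_sq_to_K, norm_inv, Complex.norm_real, Real.norm_of_nonneg (Real.sqrt_nonneg _),
    norm_pow, RCLike.norm_ofReal, abs_norm, mul_pow, inv_pow, Real.sq_sqrt hm0.le]
  field_simp

/-- Upper bound: let `P` project onto the first `n` eigenvectors. Then `φ(1 - P)` dominates `∑ (‖w
m‖² - δ m ‖P u m‖²)` over `m < N`, where `u m = w m / √(δ m)`. The weights `‖P u m‖²` are at most
`C` and have sum at most `n C`, so the bathtub principle applies to `δ`. -/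
theorem IsResolution.sum_range_le_of_gram (h : IsResolution φ a f)
    (hδ : Antitone δ) (hδ0 : ∀ n, 0 ≤ δ n) (hw0 : ∀ n, δ n = 0 → w n = 0)
    (hdom : ∀ X : K →L[ℂ] K, X.IsPositive → ∀ N,
      ∑ n ∈ Finset.range N, (inner ℂ (w n) (X (w n))).re ≤ (φ X).re) (n N : ℕ) :
    ∑ m ∈ Finset.range n, a m ≤ (φ 1).re - ∑ m ∈ Finset.range N, ‖w m‖ ^ 2 +
      (1 + gramError δ w N) * ∑ m ∈ Finset.range n, δ m := by
  set C := 1 + gramError δ w N with hC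
  have hC0 : 0 ≤ C := by linarith [gramError_nonneg δ w N]
  set P := partialIdentity f (Finset.range n) with hP
  set A := (Finset.range N).filter (0 < δ ·) with hA
  set u : ℕ → K := fun m => ((√(δ m))⁻¹ : ℂ) • w m with hu
  have hCu : ∀ x, ∑ m ∈ A, ‖inner ℂ (u m) x‖ ^ 2 ≤ C * ‖x‖ ^ 2 := fun x =>
    sum_norm_inner_sq_le A u x
  have hpos : (1 - P).IsPositive := by
    rw [isPositive_iff_inner_nonneg]
    intro x
    rw [sub_apply, inner_sub_right, inner_partialIdentity_self, one_apply_eq_self,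
      inner_self_eq_norm_sq_to_K, sub_nonneg]
    have := Complex.real_le_real.2 (bessel_of_gram h.gram (Finset.range n) x)
    simpa using this
  have hφP : (φ P).re = ∑ m ∈ Finset.range n, a m := by
    rw [hP, partialIdentity, map_sum, Complex.re_sum]
    exact Finset.sum_congr rfl fun k _ => h.apply_rankOne k
  have hwP : ∀ m, (inner ℂ (w m) ((1 - P) (w m))).re =
      ‖w m‖ ^ 2 - δ m * ∑ k ∈ Finset.range n, ‖inner ℂ (f k) (u m)‖ ^ 2 := by
    intro m
    have e1 : (inner ℂ (w m) (w m)).re = ‖w m‖ ^ 2 := by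
      rw [inner_self_eq_norm_sq_to_K]; norm_cast
    rw [sub_apply, inner_sub_right, inner_partialIdentity_self, one_apply_eq_self, Complex.sub_re,
      Complex.ofReal_re, e1, Finset.mul_sum]
    congr 1
    refine Finset.sum_congr rfl fun k _ => ?_
    rcases (hδ0 m).eq_or_lt with h0 | h0
    · simp [hw0 m h0.symm, ← h0]
    · rw [hu, inner_smul_right, norm_mul, norm_inv, Complex.norm_real,
        Real.norm_of_nonneg (Real.sqrt_nonneg _), mul_pow, inv_pow, Real.sq_sqrt h0.le]
      field_simp
  have h1 := hdom _ hpos N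
  simp_rw [hwP] at h1
  rw [Finset.sum_sub_distrib, map_sub, Complex.sub_re, hφP] at h1
  set c : ℕ → ℝ := fun m => if m ∈ A then ∑ k ∈ Finset.range n, ‖inner ℂ (f k) (u m)‖ ^ 2 else 0
    with hc
  have hcs : HasSum c (∑ m ∈ A, ∑ k ∈ Finset.range n, ‖inner ℂ (f k) (u m)‖ ^ 2) := by
    have := hasSum_sum_of_ne_finset_zero (s := A) (L := .unconditional ℕ) (f := c)
      (fun m hm => if_neg hm)
    rwa [Finset.sum_congr rfl fun m hm => if_pos hm] at this
  obtain ⟨h2, h3⟩ := tsum_mul_le_of_antitone hδ hδ0 (c := c) (C := C)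
    (fun m => by
      simp only [hc]; split_ifs
      · exact Finset.sum_nonneg fun _ _ => by positivity
      · exact le_rfl)
    (fun m => by
      simp only [hc]
      split_ifs with hm
      · refine (bessel_of_gram h.gram _ _).trans ?_
        have h4 : ‖inner ℂ (u m) (u m)‖ ^ 2 ≤ C * ‖u m‖ ^ 2 :=
          (Finset.single_le_sum (f := fun l => ‖inner ℂ (u l) (u m)‖ ^ 2)
            (fun i _ => by positivity) hm).trans (hCu (u m))
        rw [inner_self_eq_norm_sq_to_K, norm_pow, RCLike.norm_ofReal, abs_norm] at h4
        rcases (norm_nonneg (u m)).eq_or_lt with h0 | h0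
        · rw [← h0]; simpa using hC0
        · have : 0 < ‖u m‖ ^ 2 := by positivity
          nlinarith
      · exact hC0)
    hcs.summable n (by
      rw [hcs.tsum_eq, Finset.sum_comm]
      calc ∑ k ∈ Finset.range n, ∑ m ∈ A, ‖inner ℂ (f k) (u m)‖ ^ 2
          ≤ ∑ k ∈ Finset.range n, C := Finset.sum_le_sum fun k _ => by
            simp_rw [norm_inner_symm (f k)]
            refine (hCu (f k)).trans ?_
            nlinarith [h.norm_le_one k]
        _ = n * C := by simp)
  have h4 : ∑ m ∈ Finset.range N, δ m * ∑ k ∈ Finset.range n, ‖inner ℂ (f k) (u m)‖ ^ 2 ≤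
      ∑' m, δ m * c m := by
    refine le_trans (le_of_eq (Finset.sum_congr rfl fun m hm => ?_))
      (h2.sum_le_tsum (Finset.range N) fun m _ => mul_nonneg (hδ0 m) ?_)
    · simp only [hc, hA, Finset.mem_filter, hm, true_and]
      split_ifs with h0
      · rfl
      · rw [le_antisymm (not_lt.1 h0) (hδ0 m), zero_mul, zero_mul]
    · simp only [hc]; split_ifs
      · exact Finset.sum_nonneg fun _ _ => by positivity
      · exact le_rfl
  linarith

/-- If vectors whose rank one operators add up to a density operator become orthogonal in the limit,
with squared norms tending to weights `δ` of total mass one, then the partial sums of the eigenvalue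
lists tend to those of `δ`. -/
theorem tendsto_sum_range_of_gram {T : Type*} {l : Filter T} {K : T → Type*}
    [∀ t, NormedAddCommGroup (K t)] [∀ t, InnerProductSpace ℂ (K t)]
    {φ : ∀ t, (K t →L[ℂ] K t) →ₗ[ℂ] ℂ} {a : T → ℕ → ℝ} {f : ∀ t, ℕ → K t}
    (h : ∀ t, IsResolution (φ t) (a t) (f t)) (h1 : ∀ t, φ t 1 = 1) {δ : ℕ → ℝ}
    (hδ : Antitone δ) (hδ0 : ∀ n, 0 ≤ δ n) (hδ1 : HasSum δ 1) {w : ∀ t, ℕ → K t}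
    (hw0 : ∀ t n, δ n = 0 → w t n = 0)
    (hdom : ∀ t, ∀ X : K t →L[ℂ] K t, X.IsPositive → ∀ N,
      ∑ n ∈ Finset.range N, (inner ℂ (w t n) (X (w t n))).re ≤ (φ t X).re)
    (hw : ∀ m n, Tendsto (fun t => inner ℂ (w t m) (w t n)) l
      (𝓝 (if m = n then (δ m : ℂ) else 0))) (n : ℕ) :
    Tendsto (fun t => ∑ m ∈ Finset.range n, a t m) l (𝓝 (∑ m ∈ Finset.range n, δ m)) := by
  have hn : ∀ m, Tendsto (fun t => ‖w t m‖ ^ 2) l (𝓝 (δ m)) := fun m => by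
    have := (Complex.continuous_re.tendsto _).comp (hw m m)
    rw [if_pos rfl, Complex.ofReal_re] at this
    refine this.congr fun t => ?_
    rw [Function.comp, inner_self_eq_norm_sq_to_K]
    norm_cast
  have hE := tendsto_gramError hw
  rw [tendsto_order]
  constructor
  · intro x hx
    have h2 : Tendsto (fun t => (∑ m ∈ Finset.range n with 0 < δ m, ‖w t m‖ ^ 4 / δ m) /
        (1 + gramError δ (w t) n)) l (𝓝 (∑ m ∈ Finset.range n, δ m)) := by
      have h3 := (tendsto_finsetSum ((Finset.range n).filter (0 < δ ·)) fun m _ =>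
        ((hn m).pow 2).div_const (δ m)).div ((hE n).const_add 1) (by norm_num)
      have e : ∑ m ∈ Finset.range n with 0 < δ m, δ m ^ 2 / δ m = ∑ m ∈ Finset.range n, δ m := by
        rw [Finset.sum_filter]
        refine Finset.sum_congr rfl fun m _ => ?_
        split_ifs with h0
        · field_simp
        · exact le_antisymm (hδ0 m) (not_lt.1 h0)
      rw [e, add_zero, div_one] at h3
      refine h3.congr fun t => ?_
      simp_rw [← pow_mul]
      rfl
    filter_upwards [h2.eventually (lt_mem_nhds hx)] with t ht
    refine ht.trans_le ?_
    rw [div_le_iff₀' (by linarith [gramError_nonneg δ (w t) n])]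
    exact (h t).sum_norm_pow_four_div_le (hdom t) n
  · intro x hx
    -- Truncating at `N` costs, in the limit, the mass of `δ` beyond `N`; this is made smaller than
    -- the available slack.
    obtain ⟨N, hN⟩ : ∃ N, 1 - ∑ m ∈ Finset.range N, δ m < x - ∑ m ∈ Finset.range n, δ m := by
      have h2 := (hδ1.tendsto_sum_nat.const_sub 1)
      rw [sub_self] at h2
      exact (h2.eventually (gt_mem_nhds (sub_pos.2 hx))).exists
    have h2 : Tendsto (fun t => (1 : ℝ) - ∑ m ∈ Finset.range N, ‖w t m‖ ^ 2 +
        (1 + gramError δ (w t) N) * ∑ m ∈ Finset.range n, δ m) l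
        (𝓝 (1 - ∑ m ∈ Finset.range N, δ m + (1 + 0) * ∑ m ∈ Finset.range n, δ m)) :=
      ((tendsto_finsetSum _ fun m _ => hn m).const_sub 1).add
        (((hE N).const_add 1).mul_const _)
    filter_upwards [h2.eventually (gt_mem_nhds (show _ < x by linarith))] with t ht
    have h3 := (h t).sum_range_le_of_gram hδ hδ0 (hw0 t) (hdom t) n N
    rw [h1, Complex.one_re] at h3
    exact h3.trans_lt ht

/-- Scheffé's argument: as both masses are one, the `ℓ¹` distance is twice the sum of the positive
parts of `δ - a t`, which `δ` dominates. -/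
theorem tendsto_tsum_abs_sub {T : Type*} {l : Filter T} {a : T → ℕ → ℝ} {δ : ℕ → ℝ}
    (ha : ∀ t, HasSum (a t) 1) (ha0 : ∀ t n, 0 ≤ a t n) (hδ : HasSum δ 1) (hδ0 : ∀ n, 0 ≤ δ n)
    (h : ∀ n, Tendsto (fun t => ∑ m ∈ Finset.range n, a t m) l (𝓝 (∑ m ∈ Finset.range n, δ m))) :
    Tendsto (fun t => ∑' k, |a t k - δ k|) l (𝓝 0) := by
  have hk : ∀ k, Tendsto (fun t => a t k) l (𝓝 (δ k)) := fun k => by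
    simpa [Finset.sum_range_succ] using (h (k + 1)).sub (h k)
  have hle : ∀ t k, max (δ k - a t k) 0 ≤ δ k := fun t k => by
    rw [max_le_iff]; exact ⟨by linarith [ha0 t k], hδ0 k⟩
  have h1 : Tendsto (fun t => ∑' k, max (δ k - a t k) 0) l (𝓝 (∑' _ : ℕ, (0 : ℝ))) := by
    refine tendsto_tsum_of_dominated_convergence (bound := δ) hδ.summable (fun k => ?_)
      (Eventually.of_forall fun t k => ?_)
    · simpa using ((hk k).const_sub (δ k)).max (tendsto_const_nhds (x := (0 : ℝ)))
    · rw [Real.norm_of_nonneg (le_max_right _ _)]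
      exact hle t k
  have h2 : ∀ t, ∑' k, |a t k - δ k| = 2 * ∑' k, max (δ k - a t k) 0 := fun t => by
    have hs : Summable fun k => max (δ k - a t k) 0 :=
      Summable.of_nonneg_of_le (fun k => le_max_right _ _) (hle t) hδ.summable
    have h3 := (hs.hasSum.mul_left 2).add ((ha t).sub hδ)
    rw [sub_self, add_zero] at h3
    rw [← h3.tsum_eq]
    refine tsum_congr fun k => ?_
    rcases le_total (δ k) (a t k) with h0 | h0
    · rw [abs_of_nonneg (by linarith), max_eq_right (by linarith)]; ring
    · rw [abs_of_nonpos (by linarith), max_eq_left (by linarith)]; ring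
  simp_rw [h2]
  simpa using h1.const_mul 2

end Convergence

/-! ### Weak continuity of normal functionals and endomorphisms. -/

section NormalMaps

variable {H : Type u} [NormedAddCommGroup H] [InnerProductSpace ℂ H]

open Classical in
/-- A normal positive functional is diagonal in some Hilbert basis. -/
theorem IsNormalPositive.exists_diagonalization [CompleteSpace H] {φ : (H →L[ℂ] H) →ₗ[ℂ] ℂ}
    (hφ : IsNormalPositive φ) :
    ∃ (ι : Type u) (b : HilbertBasis ι ℂ H) (r : ι → ℝ), (∀ i, 0 ≤ r i) ∧ Summable r ∧
      (∀ i j, φ (InnerProductSpace.rankOne ℂ (b i) (b j)) = if i = j then (r i : ℂ) else 0) ∧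
      ∀ T : H →L[ℂ] H, HasSum
        (fun i => inner ℂ ((√(r i) : ℂ) • b i) (T ((√(r i) : ℂ) • b i))) (φ T) := by
  obtain ⟨R, hR⟩ := hφ.exists_isDensityOperator
  obtain ⟨ι, b, r, hr0, hr, -, hsum⟩ := hR.exists_eigenbasis
  refine ⟨ι, b, r, hr0, hr, fun i j => ?_, fun T => (hsum T).congr_fun fun i => ?_⟩
  · refine (hsum _).unique ?_
    refine (hasSum_ite_eq i (if i = j then (r i : ℂ) else 0)).congr_fun fun k => ?_
    rw [InnerProductSpace.rankOne_apply, inner_smul_right, orthonormal_iff_ite.1 b.orthonormal,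
      orthonormal_iff_ite.1 b.orthonormal]
    by_cases hki : k = i
    · subst hki
      by_cases hkj : k = j
      · simp [hkj]
      · simp [hkj, Ne.symm hkj]
    · simp [hki]
  · rw [map_smul, inner_smul_left, inner_smul_right, Complex.conj_ofReal, ← mul_assoc,
      ← Complex.ofReal_mul, Real.mul_self_sqrt (hr0 i)]

theorem norm_sqrt_smul_sq {ι : Type*} (b : HilbertBasis ι ℂ H) {r : ι → ℝ} (hr0 : ∀ i, 0 ≤ r i)
    (i : ι) : ‖(√(r i) : ℂ) • b i‖ ^ 2 = r i := by
  rw [norm_smul, b.orthonormal.1, mul_one, Complex.norm_real,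
    Real.norm_of_nonneg (Real.sqrt_nonneg _), Real.sq_sqrt (hr0 i)]

theorem inner_sqrt_smul {ι : Type*} [DecidableEq ι] (b : HilbertBasis ι ℂ H) {r : ι → ℝ}
    (hr0 : ∀ i, 0 ≤ r i) (i j : ι) :
    inner ℂ ((√(r i) : ℂ) • b i) ((√(r j) : ℂ) • b j) = if i = j then (r i : ℂ) else 0 := by
  rw [inner_smul_left, inner_smul_right, orthonormal_iff_ite.1 b.orthonormal]
  split_ifs with h
  · subst h
    rw [mul_one, Complex.conj_ofReal, ← Complex.ofReal_mul, Real.mul_self_sqrt (hr0 i)]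
  · simp

theorem tendstoWeakly_partialIdentity {ι : Type*} (b : HilbertBasis ι ℂ H) :
    TendstoWeakly (partialIdentity b) atTop 1 := fun ξ η => tendsto_inner_partialIdentity b ξ η

theorem TendstoWeakly.mul_right {κ : Type*} {T : κ → H →L[ℂ] H} {l : Filter κ} {S : H →L[ℂ] H}
    (h : TendstoWeakly T l S) (A : H →L[ℂ] H) : TendstoWeakly (fun k => T k * A) l (S * A) :=
  fun ξ η => h ξ (A η)

variable [CompleteSpace H]

/-- Normal positive functionals are weakly continuous on bounded sets. -/
theorem IsNormalPositive.tendsto {φ : (H →L[ℂ] H) →ₗ[ℂ] ℂ} (hφ : IsNormalPositive φ)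
    {κ : Type*} {T : κ → H →L[ℂ] H} {l : Filter κ} {S : H →L[ℂ] H} {C : ℝ}
    (hT : ∀ᶠ k in l, ‖T k‖ ≤ C) (h : TendstoWeakly T l S) :
    Tendsto (fun k => φ (T k)) l (𝓝 (φ S)) := by
  obtain ⟨ι, b, r, hr0, hr, -, hsum⟩ := hφ.exists_diagonalization
  exact tendsto_of_hasSum_inner (x := fun i => (√(r i) : ℂ) • b i)
    (hr.congr fun i => (norm_sqrt_smul_sq b hr0 i).symm) hsum hT h

/-- Normal endomorphisms of `B(H)` are weakly continuous on bounded sets. -/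
theorem TendstoWeakly.map {β : (H →L[ℂ] H) →⋆ₐ[ℂ] (H →L[ℂ] H)} (hβ : ScottContinuous β)
    {κ : Type*} {T : κ → H →L[ℂ] H} {l : Filter κ} {S : H →L[ℂ] H} {C : ℝ}
    (hT : ∀ᶠ k in l, ‖T k‖ ≤ C) (h : TendstoWeakly T l S) :
    TendstoWeakly (fun k => β (T k)) l (β S) := by
  refine tendstoWeakly_of_inner_self fun ξ => ?_
  -- By polarization diagonal matrix entries suffice, and each is a normal positive functional of
  -- the argument of `β`.
  have hφ : IsNormalPositive (vectorFunctional ξ ∘ₗ (β : (H →L[ℂ] H) →ₗ[ℂ] (H →L[ℂ] H))) := by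
    refine ⟨fun X hX => (isNormalPositive_vectorFunctional ξ).nonneg _ ?_, ?_⟩
    · have h1 := hβ.monotone ((ContinuousLinearMap.nonneg_iff_isPositive X).2 hX)
      rw [map_zero] at h1
      exact (ContinuousLinearMap.nonneg_iff_isPositive _).1 h1
    · exact ScottContinuous.comp (f := β) (g := vectorFunctional ξ) hβ
        (isNormalPositive_vectorFunctional ξ).normal
  exact hφ.tendsto hT h

theorem norm_partialIdentity_le {ι : Type*} {b : ι → H} (hb : Orthonormal ℂ b) (F : Finset ι) :
    ‖partialIdentity b F‖ ≤ 1 :=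
  (show IsStarProjection (partialIdentity b F) from
    ⟨partialIdentity_mul_self hb F, star_partialIdentity b F⟩).norm_le

end NormalMaps

/-! ### The commutant of the range of a normal endomorphism as a `B(K)`. -/

section Commutant

variable {H : Type u} [NormedAddCommGroup H] [InnerProductSpace ℂ H] [CompleteSpace H]
  (β : (H →L[ℂ] H) →⋆ₐ[ℂ] (H →L[ℂ] H))

theorem map_rankOne_mul (x y z w : H) :
    β (rankOne ℂ x y) * β (rankOne ℂ z w) = inner ℂ y z • β (rankOne ℂ x w) := by
  rw [← map_mul, rankOne_mul_rankOne, map_smul]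

theorem map_rankOne_apply (x y z w ξ : H) :
    β (rankOne ℂ x y) (β (rankOne ℂ z w) ξ) = inner ℂ y z • β (rankOne ℂ x w) ξ :=
  congrArg (fun T => T ξ) (map_rankOne_mul β x y z w)

theorem inner_map_rankOne (x y ξ η : H) :
    inner ℂ (β (rankOne ℂ x y) ξ) η = inner ℂ ξ (β (rankOne ℂ y x) η) := by
  rw [← star_rankOne x y, map_star, ContinuousLinearMap.star_eq_adjoint,
    ContinuousLinearMap.adjoint_inner_right]

/-- The range of the projection `β (|e⟩⟨e|)`, for a unit vector `e`. -/
noncomputable def corner (e : H) : Submodule ℂ H :=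
  LinearMap.ker ((1 - β (rankOne ℂ e e) : H →L[ℂ] H) : H →ₗ[ℂ] H)

variable {β}

theorem mem_corner {e ξ : H} : ξ ∈ corner β e ↔ β (rankOne ℂ e e) ξ = ξ := by
  have : ξ ∈ corner β e ↔ ξ - β (rankOne ℂ e e) ξ = 0 := Iff.rfl
  rw [this, sub_eq_zero, eq_comm]

instance completeSpace_corner (e : H) : CompleteSpace (corner β e) :=
  (1 - β (rankOne ℂ e e)).isClosed_ker.completeSpace_coe

theorem map_rankOne_mem_corner {e : H} (he : ‖e‖ = 1) (y ξ : H) :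
    β (rankOne ℂ e y) ξ ∈ corner β e := by
  rw [mem_corner, map_rankOne_apply, inner_self_eq_norm_sq_to_K, he]
  simp

/-- The vector `β (|e⟩⟨y|) ξ` of the corner. -/
noncomputable def cornerVector {e : H} (he : ‖e‖ = 1) (y ξ : H) : corner β e :=
  ⟨β (rankOne ℂ e y) ξ, map_rankOne_mem_corner he y ξ⟩

theorem mem_centralizer_range_iff {x : H →L[ℂ] H} :
    x ∈ StarSubalgebra.centralizer ℂ (Set.range β) ↔ ∀ T, β T * x = x * β T := by
  rw [StarSubalgebra.mem_centralizer_iff]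
  constructor
  · exact fun h T => (h _ ⟨T, rfl⟩).1
  · rintro h _ ⟨T, rfl⟩
    exact ⟨h T, by rw [← map_star]; exact h _⟩

theorem apply_comm {x : H →L[ℂ] H} (hx : x ∈ StarSubalgebra.centralizer ℂ (Set.range β))
    (T : H →L[ℂ] H) (ξ : H) : β T (x ξ) = x (β T ξ) :=
  congrArg (fun S => S ξ) (mem_centralizer_range_iff.1 hx T)

variable (β) in
/-- The action of the commutant of the range of `β` on the corner. -/
noncomputable def commutantRestrict (e : H) :
    StarSubalgebra.centralizer ℂ (Set.range β) →⋆ₐ[ℂ] (corner β e →L[ℂ] corner β e) where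
  toFun x := (x : H →L[ℂ] H).restrict fun ξ hξ => by
    rw [mem_corner] at hξ ⊢
    rw [apply_comm x.2, hξ]
  map_one' := rfl
  map_mul' _ _ := rfl
  map_zero' := rfl
  map_add' _ _ := rfl
  commutes' _ := rfl
  map_star' x := by
    rw [ContinuousLinearMap.star_eq_adjoint, ContinuousLinearMap.eq_adjoint_iff]
    intro ξ η
    exact ContinuousLinearMap.adjoint_inner_left (x : H →L[ℂ] H) (η : H) (ξ : H)

theorem coe_commutantRestrict_apply (e : H) (x : StarSubalgebra.centralizer ℂ (Set.range β))
    (ξ : corner β e) : (commutantRestrict β e x ξ : H) = (x : H →L[ℂ] H) ξ := rfl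

theorem map_partialIdentity {ι : Type*} (b : ι → H) (F : Finset ι) :
    β (partialIdentity b F) = ∑ j ∈ F, β (rankOne ℂ (b j) (b j)) := by
  rw [partialIdentity, map_sum]

theorem tendsto_inner_map_partialIdentity (hβ : ScottContinuous β) {ι : Type*}
    (b : HilbertBasis ι ℂ H) (ξ η : H) :
    Tendsto (fun F => inner ℂ ξ (β (partialIdentity b F) η)) atTop (𝓝 (inner ℂ ξ η)) := by
  have := (tendstoWeakly_partialIdentity b).map hβ
    (Eventually.of_forall fun F => norm_partialIdentity_le b.orthonormal F)
  simpa using this ξ η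

/-- The operators `V j = β (|e⟩⟨b j|)` commute with `x`, and `V j* V j = β (|b j⟩⟨b j|)` add up
weakly to `1` by normality. They split `H` into copies of the corner, on each of which `x` acts in
the same way. -/
theorem hasSum_inner_cornerVector (hβ : ScottContinuous β) {ι : Type*}
    (b : HilbertBasis ι ℂ H) {e : H} (he : ‖e‖ = 1)
    (x : StarSubalgebra.centralizer ℂ (Set.range β)) (ξ : H) :
    HasSum (fun j => inner ℂ (cornerVector (β := β) he (b j) ξ)
      (commutantRestrict β e x (cornerVector he (b j) ξ))) (inner ℂ ξ ((x : H →L[ℂ] H) ξ)) := by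
  refine (tendsto_inner_map_partialIdentity hβ b ξ _).congr fun F => ?_
  rw [map_partialIdentity, sum_apply, inner_sum]
  refine Finset.sum_congr rfl fun j _ => ?_
  simp only [Submodule.coe_inner, coe_commutantRestrict_apply, cornerVector, inner_map_rankOne]
  rw [← apply_comm x.2, map_rankOne_apply, inner_self_eq_norm_sq_to_K, he]
  simp

theorem commutantRestrict_injective (hβ : ScottContinuous β) {e : H} (he : ‖e‖ = 1) :
    Function.Injective (commutantRestrict β e) := by
  rw [injective_iff_map_eq_zero]
  intro x hx
  obtain ⟨w, b, -⟩ := exists_hilbertBasis ℂ H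
  have h : ∀ ξ, inner ℂ ξ ((x : H →L[ℂ] H) ξ) = 0 := fun ξ => by
    have := hasSum_inner_cornerVector hβ b he x ξ
    rw [hx] at this
    exact this.unique (by simp)
  refine Subtype.ext (ContinuousLinearMap.coe_injective
    ((inner_map_self_eq_zero ((x : H →L[ℂ] H) : H →ₗ[ℂ] H)).1 fun ξ => ?_))
  rw [← inner_conj_symm]
  exact (congrArg _ (h ξ)).trans (map_zero _)

theorem TendstoWeakly.mul_left {κ : Type*} {T : κ → H →L[ℂ] H} {l : Filter κ} {S : H →L[ℂ] H}
    (h : TendstoWeakly T l S) (A : H →L[ℂ] H) : TendstoWeakly (fun k => A * T k) l (A * S) := by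
  intro ξ η
  have := h (A.adjoint ξ) η
  simpa [ContinuousLinearMap.adjoint_inner_left] using this

/-- A compression of `T` by two finite rank projections is a finite combination of matrix units. The
two projections are let go to `1` one after the other, since multiplication is only separately
weakly continuous. -/
theorem commute_of_commute_matrixUnits (hβ : ScottContinuous β) {ι : Type*}
    (b : HilbertBasis ι ℂ H) {x : H →L[ℂ] H}
    (hx : ∀ k l, x * β (rankOne ℂ (b k) (b l)) = β (rankOne ℂ (b k) (b l)) * x) (T : H →L[ℂ] H) :
    x * β T = β T * x := by
  have hlim : ∀ (S : Finset ι → H →L[ℂ] H) (A : H →L[ℂ] H) (C : ℝ), TendstoWeakly S atTop A →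
      (∀ F, ‖S F‖ ≤ C) → (∀ F, x * β (S F) = β (S F) * x) → x * β A = β A * x := by
    intro S A C hS hC hcomm
    have h := hS.map hβ (Eventually.of_forall hC)
    exact (h.mul_left x).unique ((h.mul_right x).congr' (Eventually.of_forall fun F => (hcomm F).symm))
  have hP := tendstoWeakly_partialIdentity b
  have hn := norm_partialIdentity_le b.orthonormal
  refine hlim (fun F => partialIdentity b F * T) T (1 * ‖T‖) (by simpa using hP.mul_right T)
    (fun F => (norm_mul_le _ _).trans (by gcongr; exact hn F)) fun F => ?_
  refine hlim (fun G => partialIdentity b F * T * partialIdentity b G) _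
    (‖partialIdentity b F * T‖ * 1) (by simpa using hP.mul_left (partialIdentity b F * T))
    (fun G => (norm_mul_le _ _).trans (by gcongr; exact hn G)) fun G => ?_
  have e : partialIdentity b F * T * partialIdentity b G =
      ∑ k ∈ F, ∑ l ∈ G, inner ℂ (b k) (T (b l)) • rankOne ℂ (b k) (b l) := by
    simp only [partialIdentity, Finset.sum_mul, Finset.mul_sum]
    rw [Finset.sum_comm]
    refine Finset.sum_congr rfl fun k _ => Finset.sum_congr rfl fun l _ => ?_
    rw [mul_assoc, show T * rankOne ℂ (b l) (b l) = rankOne ℂ (T (b l)) (b l) from comp_rankOne _ _ _,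
      rankOne_mul_rankOne]
  simp only [e, map_sum, map_smul, Finset.mul_sum, Finset.sum_mul, mul_smul_comm, smul_mul_assoc, hx]

/-- An operator on the corner is copied along the diagonal: `x = ∑ E j i₀ Y E i₀ j`. The partial
sums `X F` are bounded by `‖Y‖`, so they have a weak limit along an ultrafilter; `X F` commutes with
`E k l` once `F` contains `k` and `l`. -/
theorem commutantRestrict_surjective (hβ : ScottContinuous β) {ι : Type*} (b : HilbertBasis ι ℂ H)
    (i₀ : ι) : Function.Surjective (commutantRestrict β (b i₀)) := by
  classical
  intro y
  have he : ‖b i₀‖ = 1 := b.orthonormal.1 i₀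
  have hgram := orthonormal_iff_ite.1 b.orthonormal
  set E : ι → ι → H →L[ℂ] H := fun i j => β (rankOne ℂ (b i) (b j)) with hE
  have hEE : ∀ i j k l, E i j * E k l = if j = k then E i l else 0 := fun i j k l => by
    simp only [hE, map_rankOne_mul, hgram]
    split_ifs <;> simp
  let p : H →L[ℂ] corner β (b i₀) := (E i₀ i₀).codRestrict _ (map_rankOne_mem_corner he (b i₀))
  set Y : H →L[ℂ] H := (corner β (b i₀)).subtypeL ∘L y ∘L p with hY
  have hEY : E i₀ i₀ * Y = Y := by
    ext ξ
    exact mem_corner.1 (y (p ξ)).2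
  have hYE : Y * E i₀ i₀ = Y := by
    ext ξ
    have : p (E i₀ i₀ ξ) = p ξ := Subtype.ext (congrArg (fun T => T ξ) ((hEE i₀ i₀ i₀ i₀).trans (if_pos rfl)))
    change ((y (p (E i₀ i₀ ξ)) : corner β (b i₀)) : H) = y (p ξ)
    rw [this]
  set X : Finset ι → H →L[ℂ] H := fun F => ∑ j ∈ F, E j i₀ * Y * E i₀ j with hX
  have hnorm : ∀ F, ‖X F‖ ≤ ‖Y‖ := by
    intro F
    -- A Bessel inequality for the operators `E i₀ j`. With Cauchy-Schwarz it bounds `⟨X F η, X F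
    -- η⟩` by `‖Y‖ ‖X F η‖ ‖η‖`, independently of the size of `F`.
    have hsq : ∀ ξ, ∑ j ∈ F, ‖E i₀ j ξ‖ ^ 2 ≤ ‖ξ‖ ^ 2 := by
      intro ξ
      have h1 : ∑ j ∈ F, ‖E i₀ j ξ‖ ^ 2 = (inner ℂ ξ (β (partialIdentity b F) ξ)).re := by
        rw [map_partialIdentity, sum_apply, inner_sum, Complex.re_sum]
        refine Finset.sum_congr rfl fun j _ => ?_
        have h2 : inner ℂ (E i₀ j ξ) (E i₀ j ξ) = inner ℂ ξ (E j j ξ) := by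
          simp only [hE]
          rw [inner_map_rankOne, map_rankOne_apply, hgram, if_pos rfl, one_smul]
        rw [← h2, inner_self_eq_norm_sq_to_K]
        norm_cast
      rw [h1]
      have h3 : ‖β (partialIdentity b F)‖ ≤ 1 :=
        (NonUnitalStarAlgHom.norm_apply_le β _).trans (norm_partialIdentity_le b.orthonormal F)
      calc (inner ℂ ξ (β (partialIdentity b F) ξ)).re ≤ ‖inner ℂ ξ (β (partialIdentity b F) ξ)‖ :=
            Complex.re_le_norm _
        _ ≤ ‖β (partialIdentity b F)‖ * ‖ξ‖ ^ 2 := norm_inner_apply_self_le _ _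
        _ ≤ 1 * ‖ξ‖ ^ 2 := by gcongr
        _ = ‖ξ‖ ^ 2 := one_mul _
    refine ContinuousLinearMap.opNorm_le_bound _ (norm_nonneg _) fun η => ?_
    have h1 : ‖X F η‖ ^ 2 ≤ ‖Y‖ * (‖X F η‖ * ‖η‖) := by
      have h2 : inner ℂ (X F η) (X F η) =
          ∑ j ∈ F, inner ℂ (E i₀ j (X F η)) (Y (E i₀ j η)) := by
        conv_lhs => enter [3]; rw [hX]
        simp only [sum_apply, inner_sum]
        exact Finset.sum_congr rfl fun j _ => (inner_map_rankOne β _ _ _ _).symm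
      have h3 : ‖X F η‖ ^ 2 = ‖inner ℂ (X F η) (X F η)‖ := by
        rw [inner_self_eq_norm_sq_to_K]; simp
      rw [h3, h2]
      calc ‖∑ j ∈ F, inner ℂ (E i₀ j (X F η)) (Y (E i₀ j η))‖
          ≤ ∑ j ∈ F, ‖Y‖ * (‖E i₀ j (X F η)‖ * ‖E i₀ j η‖) := by
            refine norm_sum_le_of_le _ fun j _ => (norm_inner_le_norm _ _).trans ?_
            calc ‖E i₀ j (X F η)‖ * ‖Y (E i₀ j η)‖ ≤ ‖E i₀ j (X F η)‖ * (‖Y‖ * ‖E i₀ j η‖) := by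
                  gcongr; exact Y.le_opNorm _
              _ = _ := by ring
        _ = ‖Y‖ * ∑ j ∈ F, ‖E i₀ j (X F η)‖ * ‖E i₀ j η‖ := by rw [Finset.mul_sum]
        _ ≤ ‖Y‖ * (√(∑ j ∈ F, ‖E i₀ j (X F η)‖ ^ 2) * √(∑ j ∈ F, ‖E i₀ j η‖ ^ 2)) := by
            gcongr; exact Real.sum_mul_le_sqrt_mul_sqrt _ _ _
        _ ≤ ‖Y‖ * (√(‖X F η‖ ^ 2) * √(‖η‖ ^ 2)) := by gcongr <;> exact hsq _
        _ = _ := by rw [Real.sqrt_sq (norm_nonneg _), Real.sqrt_sq (norm_nonneg _)]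
    rcases (norm_nonneg (X F η)).eq_or_lt with h0 | h0
    · rw [← h0]; positivity
    · refine le_of_mul_le_mul_left ?_ h0
      calc ‖X F η‖ * ‖X F η‖ = ‖X F η‖ ^ 2 := by ring
        _ ≤ _ := h1
        _ = _ := by ring
  have hXE : ∀ k l F, k ∈ F → l ∈ F → X F * E k l = E k l * X F := by
    intro k l F hk hl
    have h1 : X F * E k l = E k i₀ * Y * E i₀ l := by
      simp only [hX, Finset.sum_mul, mul_assoc, hEE, mul_ite, mul_zero, Finset.sum_ite_eq', hk, if_true]
    have h2 : E k l * X F = E k i₀ * Y * E i₀ l := by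
      simp only [hX, Finset.mul_sum, ← mul_assoc, hEE, ite_mul, zero_mul, Finset.sum_ite_eq, hl, if_true]
    rw [h1, h2]
  set U := Ultrafilter.of (atTop : Filter (Finset ι)) with hU
  have hUle : (U : Filter (Finset ι)) ≤ atTop := Ultrafilter.of_le _
  obtain ⟨x, hx⟩ := exists_tendstoWeakly U X ‖Y‖ (Eventually.of_forall hnorm)
  have hxE : ∀ k l, x * E k l = E k l * x := by
    intro k l
    refine (hx.mul_right (E k l)).unique ((hx.mul_left (E k l)).congr' ?_)
    filter_upwards [hUle (eventually_ge_atTop ({k, l} : Finset ι))] with F hF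
    have hF' : {k, l} ⊆ F := hF
    exact (hXE k l F (hF' (by simp)) (hF' (by simp))).symm
  have hxc : x ∈ StarSubalgebra.centralizer ℂ (Set.range β) :=
    mem_centralizer_range_iff.2 fun T => (commute_of_commute_matrixUnits hβ b hxE T).symm
  have hxY : x * E i₀ i₀ = Y := by
    refine (hx.mul_right (E i₀ i₀)).unique (TendstoWeakly.congr' (T := fun _ => Y)
      (fun _ _ => tendsto_const_nhds) ?_)
    filter_upwards [hUle (eventually_ge_atTop ({i₀} : Finset ι))] with F hF
    have hF' : {i₀} ⊆ F := hF
    simp only [hX, Finset.sum_mul, mul_assoc, hEE, mul_ite, mul_zero, Finset.sum_ite_eq',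
      hF' (Finset.mem_singleton_self i₀), if_true]
    rw [hYE, hEY]
  refine ⟨⟨x, hxc⟩, ?_⟩
  ext ξ
  have h1 : p ξ = ξ := Subtype.ext (mem_corner.1 ξ.2)
  have h2 := congrArg (fun T => T (ξ : H)) hxY
  change x (E i₀ i₀ (ξ : H)) = (y (p ξ) : H) at h2
  rw [h1, show E i₀ i₀ (ξ : H) = ξ from mem_corner.1 ξ.2] at h2
  exact h2

theorem exists_starAlgEquiv_commutant (hβ : ScottContinuous β) {ι : Type*} (b : HilbertBasis ι ℂ H)
    (i₀ : ι) :
    ∃ θ : (corner β (b i₀) →L[ℂ] corner β (b i₀)) ≃⋆ₐ[ℂ]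
      StarSubalgebra.centralizer ℂ (Set.range β), ∀ y, commutantRestrict β (b i₀) (θ y) = y := by
  let e := StarAlgEquiv.ofBijective (commutantRestrict β (b i₀))
    ⟨commutantRestrict_injective hβ (b.orthonormal.1 i₀), commutantRestrict_surjective hβ b i₀⟩
  exact ⟨e.symm, fun y => e.apply_symm_apply y⟩

end Commutant

/-! ### Families of vectors with arbitrary index sets. -/

section Families

/-- The map `g` remembers which index carries each positive weight, so that vectors can be
rearranged along with the weights. -/
theorem exists_antitone_rearrangement_map {ι : Type*} {d : ι → ℝ} {c : ℝ} (hd : HasSum d c)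
    (hd0 : ∀ i, 0 ≤ d i) :
    ∃ (δ : ℕ → ℝ) (g : {n // 0 < δ n} → ι), Antitone δ ∧ (∀ n, 0 ≤ δ n) ∧ HasSum δ c ∧
      Function.Injective g ∧ ∀ n, d (g n) = δ n := by
  obtain ⟨δ, hδ, hδ0, -, hfib⟩ := exists_antitone_rearrangement hd.summable hd0
  obtain ⟨e, he⟩ := exists_equiv_of_encard_fiber_eq (fun μ hμ =>
    (hd.summable.finite_le_of_pos hμ).subset fun i hi => le_of_eq (Eq.symm hi)) hfib
  refine ⟨δ, fun n => e ⟨n.1, n.2⟩, hδ, hδ0, ?_, fun m n hmn => ?_, fun n => he ⟨n.1, n.2⟩⟩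
  · have h1 : HasSum (fun i : {i | 0 < d i} => d i) c := by
      refine (Subtype.val_injective.hasSum_iff fun i hi => ?_).2 hd
      rw [Subtype.range_coe] at hi
      exact le_antisymm (not_lt.1 hi) (hd0 i)
    have h2 := e.hasSum_iff.2 h1
    refine (Subtype.val_injective.hasSum_iff fun n hn => ?_).1
      (h2.congr_fun fun n => (he n).symm)
    rw [Subtype.range_coe] at hn
    exact le_antisymm (not_lt.1 hn) (hδ0 n)
  · have := e.injective (Subtype.val_injective hmn)
    exact Subtype.ext (Subtype.mk_eq_mk.1 this)

theorem sum_range_inner_le {K : Type*} [NormedAddCommGroup K] [InnerProductSpace ℂ K]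
    {φ : (K →L[ℂ] K) →ₗ[ℂ] ℂ} {ι : Type*} {v : ι → K}
    (hv : ∀ X : K →L[ℂ] K, HasSum (fun i => inner ℂ (v i) (X (v i))) (φ X)) {p : ℕ → Prop}
    [DecidablePred p] {g : {n // p n} → ι} (hg : Function.Injective g) {X : K →L[ℂ] K}
    (hX : X.IsPositive) (N : ℕ) :
    ∑ n ∈ Finset.range N, (inner ℂ (if h : p n then v (g ⟨n, h⟩) else 0)
      (X (if h : p n then v (g ⟨n, h⟩) else 0))).re ≤ (φ X).re := by
  have h1 := Complex.hasSum_re (hv X)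
  have h2 := sum_le_hasSum (((Finset.range N).subtype p).map ⟨g, hg⟩)
    (fun i _ => hX.re_inner_nonneg_right (v i)) h1
  rw [Finset.sum_map] at h2
  refine le_trans (le_of_eq ?_) h2
  rw [← Finset.sum_filter_of_ne (p := p), ← Finset.sum_subtype_eq_sum_filter]
  · refine Finset.sum_congr rfl fun n _ => ?_
    simp [n.2]
  · intro n _ hn
    by_contra h
    simp [h] at hn

/-- Relabelling along `g` reduces this to sequences. Vectors outside the range of `g` are dropped,
so the identity for `φ t` becomes the inequality that the Gram argument needs. -/
theorem tendsto_sum_range_of_family {T : Type*} {l : Filter T} {K : T → Type*}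
    [∀ t, NormedAddCommGroup (K t)] [∀ t, InnerProductSpace ℂ (K t)]
    {φ : ∀ t, (K t →L[ℂ] K t) →ₗ[ℂ] ℂ} {a : T → ℕ → ℝ} {f : ∀ t, ℕ → K t}
    (h : ∀ t, IsResolution (φ t) (a t) (f t)) (h1 : ∀ t, φ t 1 = 1) {ι : Type*} [DecidableEq ι]
    {d : ι → ℝ} {δ : ℕ → ℝ} (hδ : Antitone δ) (hδ0 : ∀ n, 0 ≤ δ n) (hδ1 : HasSum δ 1)
    {g : {n // 0 < δ n} → ι} (hg : Function.Injective g) (hgd : ∀ n, d (g n) = δ n)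
    {v : ∀ t, ι → K t}
    (hv : ∀ t, ∀ X : K t →L[ℂ] K t, HasSum (fun i => inner ℂ (v t i) (X (v t i))) (φ t X))
    (hgram : ∀ i j, Tendsto (fun t => inner ℂ (v t i) (v t j)) l
      (𝓝 (if i = j then (d i : ℂ) else 0))) (n : ℕ) :
    Tendsto (fun t => ∑ m ∈ Finset.range n, a t m) l (𝓝 (∑ m ∈ Finset.range n, δ m)) := by
  refine tendsto_sum_range_of_gram h h1 hδ hδ0 hδ1
    (w := fun t n => if h : 0 < δ n then v t (g ⟨n, h⟩) else 0)
    (fun t n hn => by simp [hn]) (fun t X hX N => sum_range_inner_le (hv t) hg hX N)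
    (fun m n => ?_) n
  by_cases hm : 0 < δ m
  · by_cases hn : 0 < δ n
    · simp only [hm, hn, dif_pos]
      have := hgram (g ⟨m, hm⟩) (g ⟨n, hn⟩)
      simp only [hg.eq_iff, Subtype.mk_eq_mk, hgd] at this
      exact this
    · have : m ≠ n := by rintro rfl; exact hn hm
      simpa [hn, this] using tendsto_const_nhds
  · have : δ m = 0 := le_antisymm (not_lt.1 hm) (hδ0 m)
    simpa [this] using tendsto_const_nhds

theorem summable_norm_sq_prod {K : Type*} [NormedAddCommGroup K] {ι J : Type*} {v : ι × J → K}
    {N : ι → ℝ} (h1 : ∀ i, HasSum (fun j => ‖v (i, j)‖ ^ 2) (N i)) (hN : Summable N) :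
    Summable fun p => ‖v p‖ ^ 2 := by
  rw [summable_prod_of_nonneg (fun p => by positivity)]
  refine ⟨fun i => (h1 i).summable, hN.congr fun i => ((h1 i).tsum_eq).symm⟩

theorem summable_inner_apply {K : Type*} [NormedAddCommGroup K] [InnerProductSpace ℂ K]
    {ι : Type*} {v : ι → K} (hv : Summable fun i => ‖v i‖ ^ 2) (T : K →L[ℂ] K) :
    Summable fun i => inner ℂ (v i) (T (v i)) :=
  .of_norm_bounded (hv.mul_left ‖T‖) fun i => norm_inner_apply_self_le T (v i)

theorem hasSum_inner_prod {K : Type*} [NormedAddCommGroup K] [InnerProductSpace ℂ K]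
    {ι J : Type*} {v : ι × J → K} (hv : Summable fun p => ‖v p‖ ^ 2) (T : K →L[ℂ] K)
    {g : ι → ℂ} {z : ℂ} (h : ∀ i, HasSum (fun j => inner ℂ (v (i, j)) (T (v (i, j)))) (g i))
    (hg : HasSum g z) : HasSum (fun p => inner ℂ (v p) (T (v p))) z := by
  have h1 := (summable_inner_apply hv T).hasSum
  rwa [(h1.prod_fiberwise h).unique hg] at h1

/-- The functional `T ↦ ∑ ⟨x i, T (x i)⟩`. -/
noncomputable def sumFunctional {K : Type*} [NormedAddCommGroup K] [InnerProductSpace ℂ K]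
    {ι : Type*} (x : ι → K) (hx : Summable fun i => ‖x i‖ ^ 2) : (K →L[ℂ] K) →ₗ[ℂ] ℂ where
  toFun T := ∑' i, inner ℂ (x i) (T (x i))
  map_add' S T := by
    rw [← (summable_inner_apply hx S).tsum_add (summable_inner_apply hx T)]
    simp
  map_smul' c T := by
    simp [tsum_mul_left]

theorem hasSum_sumFunctional {K : Type*} [NormedAddCommGroup K] [InnerProductSpace ℂ K]
    {ι : Type*} (x : ι → K) (hx : Summable fun i => ‖x i‖ ^ 2) (T : K →L[ℂ] K) :
    HasSum (fun i => inner ℂ (x i) (T (x i))) (sumFunctional x hx T) :=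
  (summable_inner_apply hx T).hasSum

end Families

/-! ### Product states on the Hilbert space tensor product. -/

section ProductStates

variable {H : Type u} [NormedAddCommGroup H] [InnerProductSpace ℂ H]

theorem IsNormalState.isNormalPositive {φ : (H →L[ℂ] H) →ₗ[ℂ] ℂ} (h : IsNormalState φ) :
    IsNormalPositive φ := ⟨h.nonneg, h.normal⟩

/-- Normal positive functionals are determined by their values on rank one operators. -/
theorem IsNormalPositive.ext [CompleteSpace H] {φ ψ : (H →L[ℂ] H) →ₗ[ℂ] ℂ}
    (hφ : IsNormalPositive φ) (hψ : IsNormalPositive ψ)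
    (h : ∀ x y, φ (rankOne ℂ x y) = ψ (rankOne ℂ x y)) : φ = ψ := by
  obtain ⟨w, b, -⟩ := exists_hilbertBasis ℂ H
  ext T
  have hlim : TendstoWeakly (fun F => T * partialIdentity b F) atTop T := by
    simpa using (tendstoWeakly_partialIdentity b).mul_left T
  have hbd : ∀ F, ‖T * partialIdentity b F‖ ≤ ‖T‖ * 1 := fun F =>
    (norm_mul_le _ _).trans (by gcongr; exact norm_partialIdentity_le b.orthonormal F)
  refine tendsto_nhds_unique (hφ.tendsto (Eventually.of_forall hbd) hlim)
    ((hψ.tendsto (Eventually.of_forall hbd) hlim).congr fun F => ?_)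
  rw [partialIdentity, Finset.mul_sum, map_sum, map_sum]
  refine Finset.sum_congr rfl fun i _ => ?_
  rw [show T * rankOne ℂ (b i) (b i) = rankOne ℂ (T (b i)) (b i) from comp_rankOne _ _ _, h]

/-- The elementary tensor `x ⊗ y` in the Hilbert space tensor product. -/
noncomputable def elementaryTensor (x y : H) : HilbertTensor H :=
  ((x ⊗ₜ[ℂ] y : H ⊗[ℂ] H) : UniformSpace.Completion (H ⊗[ℂ] H))

theorem inner_elementaryTensor (x y x' y' : H) :
    inner ℂ (elementaryTensor x y) (elementaryTensor x' y') = inner ℂ x x' * inner ℂ y y' := by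
  rw [elementaryTensor, elementaryTensor, UniformSpace.Completion.inner_coe,
    TensorProduct.inner_tmul]

theorem norm_elementaryTensor (x y : H) : ‖elementaryTensor x y‖ = ‖x‖ * ‖y‖ := by
  rw [elementaryTensor, UniformSpace.Completion.norm_coe, TensorProduct.norm_tmul]

theorem tensorOp_elementaryTensor (S T : H →L[ℂ] H) (x y : H) :
    tensorOp S T (elementaryTensor x y) = elementaryTensor (S x) (T y) := by
  rw [tensorOp, elementaryTensor, ContinuousLinearMap.completion_apply_coe,
    TensorProduct.mapL_tmul]
  rfl

theorem HilbertTensor.induction {p : HilbertTensor H → Prop} (hp : IsClosed {z | p z})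
    (zero : p 0) (add : ∀ z w, p z → p w → p (z + w)) (tmul : ∀ x y, p (elementaryTensor x y))
    (z : HilbertTensor H) : p z := by
  refine UniformSpace.Completion.induction_on z hp fun z => ?_
  induction z using TensorProduct.induction_on with
  | zero => rwa [UniformSpace.Completion.coe_zero]
  | add z w hz hw => rw [UniformSpace.Completion.coe_add]; exact add _ _ hz hw
  | tmul a b => exact tmul a b

theorem HilbertTensor.clm_ext {A B : HilbertTensor H →L[ℂ] HilbertTensor H}
    (h : ∀ x y, A (elementaryTensor x y) = B (elementaryTensor x y)) : A = B := by
  ext z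
  refine HilbertTensor.induction (p := fun z => A z = B z) (isClosed_eq A.continuous B.continuous)
    (by rw [map_zero, map_zero]) (fun z w hz hw => ?_) h z
  rw [map_add, map_add, hz, hw]

theorem smul_elementaryTensor_smul (c d : ℂ) (x y : H) :
    elementaryTensor (c • x) (d • y) = (c * d) • elementaryTensor x y := by
  rw [elementaryTensor, TensorProduct.smul_tmul_smul, UniformSpace.Completion.coe_smul]
  rfl

theorem tensorOp_one : tensorOp (1 : H →L[ℂ] H) 1 = 1 :=
  HilbertTensor.clm_ext fun x y => tensorOp_elementaryTensor 1 1 x y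

theorem rankOne_elementaryTensor (x y x' y' : H) :
    rankOne ℂ (elementaryTensor x y) (elementaryTensor x' y') =
      tensorOp (rankOne ℂ x x') (rankOne ℂ y y') := by
  refine HilbertTensor.clm_ext fun a b => ?_
  rw [tensorOp_elementaryTensor, rankOne_apply, inner_elementaryTensor, rankOne_apply,
    rankOne_apply, smul_elementaryTensor_smul]

theorem induction_of_dense_span {K : Type*} [NormedAddCommGroup K] [InnerProductSpace ℂ K]
    {s : Set K} (hs : Dense (Submodule.span ℂ s : Set K)) {p : K → Prop} (hp : IsClosed {z | p z})
    (zero : p 0) (add : ∀ z w, p z → p w → p (z + w)) (smul : ∀ (c : ℂ) z, p z → p (c • z))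
    (mem : ∀ x ∈ s, p x) (z : K) : p z := by
  refine hp.closure_subset_iff.2 (fun w hw => ?_) (hs z)
  induction hw using Submodule.span_induction with
  | mem x h => exact mem x h
  | zero => exact zero
  | add x y _ _ hx hy => exact add x y hx hy
  | smul c x _ hx => exact smul c x hx

theorem continuous_rankOne_left {K : Type*} [NormedAddCommGroup K] [InnerProductSpace ℂ K]
    (y : K) : Continuous fun x : K => rankOne ℂ x y := by
  have h : Continuous (rankOne ℂ : K → K →L⋆[ℂ] K →L[ℂ] K) := ContinuousLinearMap.continuous _
  exact (ContinuousLinearMap.apply' (K →L[ℂ] K) (starRingEnd ℂ) y).continuous.comp h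

theorem hasSum_mul_prod {ι J : Type*} {f : ι → ℂ} {g : J → ℂ} {a b : ℂ} (hf : HasSum f a)
    (hg : HasSum g b) : HasSum (fun p : ι × J => f p.1 * g p.2) (a * b) :=
  hf.mul hg (summable_mul_of_summable_norm hf.summable.norm hg.summable.norm)

theorem IsNormalPositive.ext_of_dense_span {K : Type*} [NormedAddCommGroup K]
    [InnerProductSpace ℂ K] [CompleteSpace K] {φ ψ : (K →L[ℂ] K) →ₗ[ℂ] ℂ}
    (hφ : IsNormalPositive φ) (hψ : IsNormalPositive ψ) {s : Set K}
    (hs : Dense (Submodule.span ℂ s : Set K))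
    (h : ∀ x ∈ s, ∀ y ∈ s, φ (rankOne ℂ x y) = ψ (rankOne ℂ x y)) : φ = ψ := by
  have hc1 : ∀ {φ : (K →L[ℂ] K) →ₗ[ℂ] ℂ}, IsNormalPositive φ → ∀ y,
      Continuous fun x => φ (rankOne ℂ x y) := fun {φ} hφ y =>
    (φ.mkContinuous (φ 1).re (norm_apply_le_of_nonneg hφ.nonneg)).continuous.comp
      (continuous_rankOne_left y)
  have hc2 : ∀ {φ : (K →L[ℂ] K) →ₗ[ℂ] ℂ}, IsNormalPositive φ → ∀ x,
      Continuous fun y => φ (rankOne ℂ x y) := fun {φ} hφ x =>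
    (φ.mkContinuous (φ 1).re (norm_apply_le_of_nonneg hφ.nonneg)).continuous.comp
      (rankOne ℂ x).continuous
  refine hφ.ext hψ fun x y => ?_
  refine induction_of_dense_span hs (p := fun x => φ (rankOne ℂ x y) = ψ (rankOne ℂ x y))
    (isClosed_eq (hc1 hφ y) (hc1 hψ y)) (by simp) (fun z w hz hw => by simp [hz, hw])
    (fun c z hz => by simp [hz]) (fun x hx => ?_) x
  exact induction_of_dense_span hs (p := fun y => φ (rankOne ℂ x y) = ψ (rankOne ℂ x y))
    (isClosed_eq (hc2 hφ x) (hc2 hψ x)) (by simp) (fun z w hz hw => by simp [hz, hw])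
    (fun c z hz => by simp [hz]) (fun y hy => h x hx y hy) y

theorem dense_span_elementaryTensor : Dense (Submodule.span ℂ
    (Set.range fun p : H × H => elementaryTensor p.1 p.2) : Set (HilbertTensor H)) := fun z =>
  HilbertTensor.induction (p := fun z => z ∈ closure (Submodule.span ℂ
    (Set.range fun p : H × H => elementaryTensor p.1 p.2) : Set (HilbertTensor H)))
    isClosed_closure (subset_closure (Submodule.zero_mem _))
    (fun _ _ hz hw => (Submodule.topologicalClosure _).add_mem hz hw)
    (fun x y => subset_closure (Submodule.subset_span ⟨(x, y), rfl⟩)) z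

/-- Rank one operators between elementary tensors are tensor products of rank one operators, so both
states agree on them; density and normality do the rest. -/
theorem IsProductState.unique {ρ ω : (H →L[ℂ] H) →ₗ[ℂ] ℂ}
    {σ τ : (HilbertTensor H →L[ℂ] HilbertTensor H) →ₗ[ℂ] ℂ} (hσ : IsProductState ρ ω σ)
    (hτ : IsProductState ρ ω τ) : σ = τ := by
  refine hσ.isNormalState.isNormalPositive.ext_of_dense_span hτ.isNormalState.isNormalPositive
    dense_span_elementaryTensor ?_
  rintro _ ⟨⟨a, b⟩, rfl⟩ _ ⟨⟨c, d⟩, rfl⟩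
  dsimp only
  rw [rankOne_elementaryTensor]
  exact (hσ.map_tensorOp _ _).trans (hτ.map_tensorOp _ _).symm

/-- A positive normal functional that is multiplicative on elementary tensors of operators is the
product state. -/
theorem IsProductState.of_isNormalPositive {ρ ω : (H →L[ℂ] H) →ₗ[ℂ] ℂ}
    (hρ : ρ 1 = 1) (hω : ω 1 = 1)
    {σ : (HilbertTensor H →L[ℂ] HilbertTensor H) →ₗ[ℂ] ℂ} (hσ : IsNormalPositive σ)
    (hmul : ∀ S T, σ (tensorOp S T) = ρ S * ω T) : IsProductState ρ ω σ := by
  have h1 : σ 1 = 1 :=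
    calc σ 1 = σ (tensorOp 1 1) := congrArg σ tensorOp_one.symm
      _ = ρ 1 * ω 1 := hmul 1 1
      _ = 1 := by rw [hρ, hω, one_mul]
  have h2 : IsNormalState σ := ⟨hσ.nonneg, h1, hσ.normal⟩
  exact ⟨h2, hmul⟩

theorem hasSum_inner_tensorOp {ρ ω : (H →L[ℂ] H) →ₗ[ℂ] ℂ}
    {ι J : Type*} {x : ι → H} {y : J → H}
    (hxρ : ∀ T : H →L[ℂ] H, HasSum (fun i => inner ℂ (x i) (T (x i))) (ρ T))
    (hyω : ∀ T : H →L[ℂ] H, HasSum (fun j => inner ℂ (y j) (T (y j))) (ω T)) (S T : H →L[ℂ] H) :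
    HasSum (fun p : ι × J => inner ℂ (elementaryTensor (x p.1) (y p.2))
      (tensorOp S T (elementaryTensor (x p.1) (y p.2)))) (ρ S * ω T) := by
  have h1 := hasSum_mul_prod (hxρ S) (hyω T)
  refine h1.congr_fun fun p => ?_
  rw [tensorOp_elementaryTensor, inner_elementaryTensor]

theorem isProductState_sumFunctional {ρ ω : (H →L[ℂ] H) →ₗ[ℂ] ℂ} (hρ : ρ 1 = 1) (hω : ω 1 = 1)
    {ι J : Type*} {x : ι → H} {y : J → H}
    (hxρ : ∀ T : H →L[ℂ] H, HasSum (fun i => inner ℂ (x i) (T (x i))) (ρ T))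
    (hyω : ∀ T : H →L[ℂ] H, HasSum (fun j => inner ℂ (y j) (T (y j))) (ω T))
    (hz : Summable fun p : ι × J => ‖elementaryTensor (x p.1) (y p.2)‖ ^ 2) :
    IsProductState ρ ω (sumFunctional (fun p : ι × J => elementaryTensor (x p.1) (y p.2)) hz) :=
  .of_isNormalPositive hρ hω (IsNormalPositive.of_hasSum hz (hasSum_sumFunctional _ hz))
    fun S T => (hasSum_sumFunctional _ hz _).unique (hasSum_inner_tensorOp hxρ hyω S T)

end ProductStates

/-! ### Weak convergence to the invariant state. -/

section Asymptotics

variable {H : Type u} [NormedAddCommGroup H] [InnerProductSpace ℂ H] [CompleteSpace H]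

/-- For a pure `E₀`-semigroup with invariant normal state `ω`, `α_t(x)` tends weakly to `ω(x)`. -/
theorem EZeroSemigroup.tendstoWeakly (α : EZeroSemigroup H) (hα : α.IsPure)
    {ω : (H →L[ℂ] H) →ₗ[ℂ] ℂ} (hω : IsNormalState ω)
    (hinv : ∀ (t : ℝ≥0) (x : H →L[ℂ] H), ω (α.toFun t x) = ω x) (x : H →L[ℂ] H) :
    TendstoWeakly (fun t => α.toFun t x) atTop (ω x • (1 : H →L[ℂ] H)) := by
  have hbd : ∀ t, ‖α.toFun t x‖ ≤ ‖x‖ := fun t => NonUnitalStarAlgHom.norm_apply_le _ _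
  intro ξ η
  rw [tendsto_iff_ultrafilter]
  intro U hU
  obtain ⟨z, hz⟩ := exists_tendstoWeakly U (fun t => α.toFun t x) ‖x‖ (Eventually.of_forall hbd)
  have hmem : ∀ t, z ∈ (α.toFun t).range := by
    intro t
    -- A preimage of `z` under `α_t` is found as a weak limit of `α_{s-t}(x)`. The subtraction is
    -- truncated, but only `s ≥ t` matters along `U`.
    obtain ⟨y, hy⟩ := exists_tendstoWeakly U (fun s => α.toFun (s - t) x) ‖x‖
      (Eventually.of_forall fun s => hbd _)
    refine ⟨y, ((hy.map (α.normal t) (C := ‖x‖) (Eventually.of_forall fun s => hbd _)).congr'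
      ?_).unique hz⟩
    filter_upwards [hU (eventually_ge_atTop t)] with s hs
    rw [← StarAlgHom.comp_apply, ← α.map_add, add_tsub_cancel_of_le hs]
  have hbot : z ∈ (⊥ : StarSubalgebra ℂ (H →L[ℂ] H)) := by
    rw [← hα, StarSubalgebra.mem_iInf]
    exact hmem
  obtain ⟨c, hc⟩ := StarSubalgebra.mem_bot.1 hbot
  have hωz : ω z = ω x := by
    refine tendsto_nhds_unique (hω.isNormalPositive.tendsto (Eventually.of_forall hbd) hz) ?_
    simp_rw [hinv]
    exact tendsto_const_nhds
  have hcω : c = ω x := by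
    rw [← hωz, ← hc, Algebra.algebraMap_eq_smul_one, map_smul, hω.map_one, smul_eq_mul, mul_one]
  rw [← hcω, ← Algebra.algebraMap_eq_smul_one, hc]
  exact hz ξ η

end Asymptotics

/-! ### Eigenvalue lists of the restrictions and of the product state. -/

section Main

/-- A functional that is a sum of vector functionals in a representation `M ≃ B(K)` has an
eigenvalue list. -/
theorem exists_isEigenvalueList {M : Type u} [Ring M] [StarRing M] [Algebra ℂ M] {φ : M →ₗ[ℂ] ℂ}
    {K : Type u} [NormedAddCommGroup K] [InnerProductSpace ℂ K] [CompleteSpace K]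
    (θ : (K →L[ℂ] K) ≃⋆ₐ[ℂ] M) {ψ : (K →L[ℂ] K) →ₗ[ℂ] ℂ} (hψ : ∀ T, ψ T = φ (θ T))
    (hn : IsNormalPositive ψ) :
    ∃ (a : ℕ → ℝ) (f : ℕ → K), (∀ a', IsEigenvalueList φ a' ↔ a' = a) ∧ IsResolution ψ a f := by
  obtain ⟨R, hR⟩ := hn.exists_isDensityOperator
  obtain ⟨a, ha⟩ := hR.exists_isOperatorEigenvalueList
  obtain ⟨f, hf⟩ := hR.exists_isResolution ha
  have hlist : IsEigenvalueList φ a :=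
    ⟨K, _, _, inferInstance, θ, R, by rwa [← funext hψ], ha⟩
  exact ⟨a, f, fun a' => ⟨fun h => h.eq hlist, fun h => h ▸ hlist⟩, hf⟩

variable {H : Type u} [NormedAddCommGroup H] [InnerProductSpace ℂ H]

theorem IsNormalState.hasSum_weights {φ : (H →L[ℂ] H) →ₗ[ℂ] ℂ} (h : IsNormalState φ)
    {ι : Type*} {b : HilbertBasis ι ℂ H} {r : ι → ℝ} (hr0 : ∀ i, 0 ≤ r i)
    (hsum : ∀ T : H →L[ℂ] H, HasSum
      (fun i => inner ℂ ((√(r i) : ℂ) • b i) (T ((√(r i) : ℂ) • b i))) (φ T)) : HasSum r 1 := by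
  have h1 := Complex.hasSum_re (hsum 1)
  rw [h.map_one, Complex.one_re] at h1
  refine h1.congr_fun fun i => ?_
  exact (norm_sqrt_smul_sq b hr0 i).symm.trans
    (norm_sq_eq_re_inner (𝕜 := ℂ) ((√(r i) : ℂ) • b i))

variable [CompleteSpace H]

/-- The Gram matrix of the vectors `β (|e⟩⟨y|) x`. -/
theorem inner_cornerVector {β : (H →L[ℂ] H) →⋆ₐ[ℂ] (H →L[ℂ] H)} {e : H} (he : ‖e‖ = 1)
    (y y' x x' : H) :
    inner ℂ (cornerVector (β := β) he y x) (cornerVector he y' x') =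
      inner ℂ x (β (rankOne ℂ y y') x') := by
  rw [Submodule.coe_inner, cornerVector, cornerVector, inner_map_rankOne, map_rankOne_apply,
    inner_self_eq_norm_sq_to_K, he]
  simp

/-- In the representation of the commutant on the corner, the restriction of
`ρ = ∑ ⟨x i, · x i⟩` is the sum of the vector functionals of the vectors
`β (|e⟩⟨c j|) (x i)`. -/
theorem hasSum_inner_cornerVector_prod {β : (H →L[ℂ] H) →⋆ₐ[ℂ] (H →L[ℂ] H)}
    (hβ : ScottContinuous β) {ρ : (H →L[ℂ] H) →ₗ[ℂ] ℂ} {ι J : Type*} {x : ι → H}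
    (hx : Summable fun i => ‖x i‖ ^ 2)
    (hρ : ∀ T : H →L[ℂ] H, HasSum (fun i => inner ℂ (x i) (T (x i))) (ρ T))
    (c : HilbertBasis J ℂ H) {e : H} (he : ‖e‖ = 1) :
    Summable (fun p : ι × J => ‖cornerVector (β := β) he (c p.2) (x p.1)‖ ^ 2) ∧
    ∀ a : StarSubalgebra.centralizer ℂ (Set.range β), HasSum (fun p : ι × J =>
      inner ℂ (cornerVector (β := β) he (c p.2) (x p.1))
        (commutantRestrict β e a (cornerVector he (c p.2) (x p.1)))) (ρ a) := by
  have h1 : Summable (fun p : ι × J => ‖cornerVector (β := β) he (c p.2) (x p.1)‖ ^ 2) := by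
    refine summable_norm_sq_prod (N := fun i => ‖x i‖ ^ 2) (fun i => ?_) hx
    have h2 := Complex.hasSum_re (hasSum_inner_cornerVector hβ c he 1 (x i))
    have h3 : ‖x i‖ ^ 2 = (inner ℂ (x i) (x i)).re := norm_sq_eq_re_inner (𝕜 := ℂ) _
    rw [h3]
    refine h2.congr_fun fun j => ?_
    exact norm_sq_eq_re_inner (𝕜 := ℂ) _
  exact ⟨h1, fun a => hasSum_inner_prod h1 _
    (fun i => hasSum_inner_cornerVector hβ c he a (x i)) (hρ a)⟩

theorem EZeroSemigroup.tendsto_inner_cornerVector (α : EZeroSemigroup H) (hα : α.IsPure)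
    {ω : (H →L[ℂ] H) →ₗ[ℂ] ℂ} (hω : IsNormalState ω)
    (hinv : ∀ (t : ℝ≥0) (x : H →L[ℂ] H), ω (α.toFun t x) = ω x) {e : H} (he : ‖e‖ = 1)
    (y y' x x' : H) :
    Tendsto (fun t => inner ℂ (cornerVector (β := α.toFun t) he y x) (cornerVector he y' x')) atTop
      (𝓝 (ω (rankOne ℂ y y') * inner ℂ x x')) := by
  have h := α.tendstoWeakly hα hω hinv (rankOne ℂ y y') x x'
  simp_rw [inner_cornerVector]
  simpa [inner_smul_right] using h

end Main

theorem theoremC {H : Type u} [NormedAddCommGroup H] [InnerProductSpace ℂ H] [CompleteSpace H]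
    [TopologicalSpace.SeparableSpace H]
    (α : EZeroSemigroup H) (hα : α.IsPure)
    (ω : (H →L[ℂ] H) →ₗ[ℂ] ℂ) (hω : IsNormalState ω)
    (hinv : ∀ (t : ℝ≥0) (x : H →L[ℂ] H), ω (α.toFun t x) = ω x)
    (ρ : (H →L[ℂ] H) →ₗ[ℂ] ℂ) (hρ : IsNormalState ρ) :
    ∃ (σ : (HilbertTensor H →L[ℂ] HilbertTensor H) →ₗ[ℂ] ℂ) (Λ : ℕ → ℝ) (Λt : ℝ≥0 → ℕ → ℝ),
      (∀ τ, IsProductState ρ ω τ ↔ τ = σ) ∧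
      (∀ a, IsEigenvalueList σ a ↔ a = Λ) ∧
      (∀ t a, IsEigenvalueList (α.restrict ρ t) a ↔ a = Λt t) ∧
      Filter.Tendsto (fun t => ∑' k, |Λt t k - Λ k|) Filter.atTop (nhds 0) := by
  classical
  obtain ⟨ι, b, r, hr0, hr, -, hρsum⟩ := hρ.isNormalPositive.exists_diagonalization
  obtain ⟨J, c, s, hs0, hs, hωc, hωsum⟩ := hω.isNormalPositive.exists_diagonalization
  have hr1 := hρ.hasSum_weights hr0 hρsum
  have hs1 := hω.hasSum_weights hs0 hωsum
  set x : ι → H := fun i => (√(r i) : ℂ) • b i with hx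
  set y : J → H := fun j => (√(s j) : ℂ) • c j with hy
  have hxn : Summable fun i => ‖x i‖ ^ 2 := hr.congr fun i => (norm_sqrt_smul_sq b hr0 i).symm
  have hd0 : ∀ p : ι × J, 0 ≤ r p.1 * s p.2 := fun p => mul_nonneg (hr0 _) (hs0 _)
  have hd : HasSum (fun p : ι × J => r p.1 * s p.2) 1 := by
    simpa using hr1.mul hs1 (hr.mul_of_nonneg hs hr0 hs0)
  obtain ⟨δ, g, hδ, hδ0, hδ1, hg, hgd⟩ := exists_antitone_rearrangement_map hd hd0
  have hz : Summable fun p : ι × J => ‖elementaryTensor (x p.1) (y p.2)‖ ^ 2 := by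
    refine hd.summable.congr fun p => ?_
    rw [norm_elementaryTensor, mul_pow, norm_sqrt_smul_sq b hr0, norm_sqrt_smul_sq c hs0]
  have hσ := isProductState_sumFunctional hρ.map_one hω.map_one hρsum hωsum hz
  have hσsum := hasSum_sumFunctional _ hz
  set σ := sumFunctional (fun p : ι × J => elementaryTensor (x p.1) (y p.2)) hz
  obtain ⟨Λ, f, hΛ, hf⟩ := exists_isEigenvalueList (φ := σ) (ψ := σ)
    (StarAlgEquiv.refl ℂ _) (fun _ => rfl) hσ.isNormalState.isNormalPositive
  -- The vectors `x i ⊗ y j` have an exactly diagonal Gram matrix with entries `r i * s j`. The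
  -- convergence theorem for this constant family, together with uniqueness of limits, computes the
  -- list of `ρ ⊗ ω`.
  have hΛδ : Λ = δ := by
    refine eq_of_sum_range_eq fun n => ?_
    refine tendsto_nhds_unique (f := fun _ : Unit => ∑ m ∈ Finset.range n, Λ m) (l := ⊤)
      tendsto_const_nhds ?_
    refine tendsto_sum_range_of_family (T := Unit) (d := fun p : ι × J => r p.1 * s p.2)
      (fun _ => hf) (fun _ => hσ.isNormalState.map_one) hδ hδ0 hδ1 hg hgd (fun _ => hσsum) (fun p q => ?_) n
    have : inner ℂ (elementaryTensor (x p.1) (y p.2)) (elementaryTensor (x q.1) (y q.2)) =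
        if p = q then ((r p.1 * s p.2 : ℝ) : ℂ) else 0 := by
      rw [inner_elementaryTensor, inner_sqrt_smul b hr0, inner_sqrt_smul c hs0]
      by_cases h1 : p.1 = q.1 <;> by_cases h2 : p.2 = q.2 <;> simp [h1, h2, Prod.ext_iff]
    rw [this]
    exact tendsto_const_nhds
  -- The weights of `ω` have sum one, so there is a basis vector to define the corner.
  obtain ⟨j₀⟩ : Nonempty J := by
    by_contra h
    rw [not_nonempty_iff] at h
    exact one_ne_zero (hs1.unique hasSum_empty)
  have he := c.orthonormal.1 j₀
  have hN : ∀ t, ∃ (ψ : (corner (α.toFun t) (c j₀) →L[ℂ] corner (α.toFun t) (c j₀)) →ₗ[ℂ] ℂ)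
      (a : ℕ → ℝ) (f : ℕ → corner (α.toFun t) (c j₀)),
      (∀ a', IsEigenvalueList (α.restrict ρ t) a' ↔ a' = a) ∧ IsResolution ψ a f ∧ ψ 1 = 1 ∧
      ∀ T, HasSum (fun p : ι × J => inner ℂ (cornerVector (β := α.toFun t) he (c p.2) (x p.1))
        (T (cornerVector he (c p.2) (x p.1)))) (ψ T) := by
    intro t
    obtain ⟨θ, hθ⟩ := exists_starAlgEquiv_commutant (α.normal t) c j₀
    obtain ⟨hv, hsum⟩ := hasSum_inner_cornerVector_prod (α.normal t) hxn hρsum c he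
    let ψ : (corner (α.toFun t) (c j₀) →L[ℂ] corner (α.toFun t) (c j₀)) →ₗ[ℂ] ℂ :=
      sumFunctional (fun p : ι × J => cornerVector (β := α.toFun t) he (c p.2) (x p.1)) hv
    have hψsum := hasSum_sumFunctional _ hv
    have hψ : ∀ T, ψ T = ρ (θ T) := fun T => by
      refine (hψsum T).unique ?_
      have := hsum (θ T)
      rwa [hθ] at this
    obtain ⟨a, f, ha, hf⟩ := exists_isEigenvalueList (φ := α.restrict ρ t) θ hψ
      (IsNormalPositive.of_hasSum hv hψsum)
    refine ⟨ψ, a, f, ha, hf, ?_, hψsum⟩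
    rw [hψ, map_one]
    exact hρ.map_one
  choose ψ Λt ft hΛt hft hψ1 hψsum using hN
  refine ⟨σ, Λ, Λt, fun τ => ⟨fun h => h.unique hσ, fun h => h ▸ hσ⟩, hΛ, hΛt, ?_⟩
  rw [hΛδ]
  refine tendsto_tsum_abs_sub (fun t => ?_) (fun t => (hft t).nonneg) hδ1 hδ0 fun n => ?_
  · have := (hft t).hasSum_weights
    rw [hψ1] at this
    exact Complex.hasSum_re this
  · refine tendsto_sum_range_of_family (d := fun p : ι × J => r p.1 * s p.2)
      hft hψ1 hδ hδ0 hδ1 hg hgd hψsum (fun p q => ?_) n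
    have h1 := α.tendsto_inner_cornerVector hα hω hinv he (c p.2) (c q.2) (x p.1) (x q.1)
    -- Since `c` diagonalizes `ω` and the `x i` are orthogonal, the limit of the Gram matrix is
    -- diagonal.
    rw [hωc, inner_sqrt_smul b hr0] at h1
    convert h1 using 2
    by_cases h1 : p.1 = q.1 <;> by_cases h2 : p.2 = q.2 <;> simp [h1, h2, Prod.ext_iff, mul_comm]
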